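/- Let $V_{\mathbb Z}$ be a free $\mathbb Z$-module of rank $n+1$ ($n\ge 0$) with an integer-valued, not necessarily unimodular, quadratic form $q$ of signature $(1,n)$, let $O(V_{\mathbb Z})$ be its group of isometries, and let $\Gamma\subset O(V_{\mathbb Z})$ be a subgroup of finite index. Put $V=V_{\mathbb Z}\otimes_{\mathbb Z}\mathbb R$ and let $\mathbb H=\mathbb P V^+$ be the $n$-dimensional hyperbolic space, that is, the projectivization of the set $V^+=\{v\in V : q(v)>0\}$. Let $S_0\subset V_{\mathbb Z}$ be a finite set of vectors with $q(s)<0$, let $S=\Gamma\cdot S_0$, and for $s\in S$ let $s^\perp\subset V$ be its orthogonal complement. For $0\le d\le n$, call a subset $S_d\subset\mathbb H$ a $d$-dimensional stratum if $S_d=\mathbb H\cap\mathbb P(s_1^\perp\cap\dots\cap s_{n-d}^\perp)$ for some linearly independent $s_1,\dots,s_{n-d}\in S$ (so that $S_n=\mathbb H$; there are no strata of dimension $-1$). A $d$-dimensional face of the tessellation of $\mathbb H$ cut out by the hyperplanes $s^\perp$, $s\in S$, is a connected component of the complement, in some $d$-dimensional stratum, of the union of all $(d-1)$-dimensional strata.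 In particular, the $n$-dimensional faces are the connected components of $\mathbb H\setminus\bigcup_{s\in S}\mathbb P(s^\perp)$. Then, for every $d$, the group $\Gamma$ maps $d$-dimensional faces to $d$-dimensional faces, and it acts on the set of all $d$-dimensional faces with finitely many orbits. -/

import Mathlib

open scoped TensorProduct LinearAlgebra.Projectivization

noncomputable section

namespace HypTess

variable {L : Type*} [AddCommGroup L]

/-- The orthogonal group `O(L, q)` of an integral quadratic form: all `ℤ`-linear automorphisms of
`L` that preserve `q`. -/
def orthogonalGroup (q : QuadraticForm ℤ L) : Subgroup (L ≃ₗ[ℤ] L) where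
  carrier := {g | ∀ v, q (g v) = q v}
  one_mem' := fun _ => rfl
  mul_mem' := by
    intro a b ha hb v
    rw [LinearEquiv.mul_apply, ha, hb]
  inv_mem' := by
    intro a ha v
    rw [← ha (a⁻¹ v), ← LinearEquiv.mul_apply, mul_inv_cancel, LinearEquiv.coe_one, id]

variable (L) in
/-- The real vector space `V = L ⊗ ℝ`. -/
abbrev RealSpace : Type _ := ℝ ⊗[ℤ] L

/-- The real bilinear form extending the polar form `q (x + y) - q x - q y` of `q`. -/
def realBilin (q : QuadraticForm ℤ L) : LinearMap.BilinForm ℝ (RealSpace L) :=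
  LinearMap.BilinForm.baseChange ℝ q.polarBilin

/-- The real quadratic form on `V = L ⊗ ℝ` extending `q`. -/
def realForm (q : QuadraticForm ℤ L) : QuadraticForm ℝ (RealSpace L) :=
  (2⁻¹ : ℝ) • (realBilin q).toQuadraticMap

theorem realForm_tmul (q : QuadraticForm ℤ L) (a : ℝ) (v : L) :
    realForm q (a ⊗ₜ[ℤ] v) = a ^ 2 * (q v : ℝ) := by
  simp [realForm, realBilin, LinearMap.BilinForm.baseChange_tmul]
  ring

theorem polar_realForm (q : QuadraticForm ℤ L) (x y : RealSpace L) :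
    QuadraticMap.polar (realForm q) x y = realBilin q x y := by
  have h : realBilin q y x = realBilin q x y := by
    simpa [realBilin] using (LinearMap.BilinForm.IsSymm.baseChange ℝ (B₂ := q.polarBilin)
      ⟨fun a b => QuadraticMap.polar_comm _ _ _⟩).eq y x
  simp [QuadraticMap.polar, realForm, h]
  ring

/-- `q` has signature `(a, b)`; in particular it is nondegenerate and `L` has rank `a + b`. -/
def HasSignature (q : QuadraticForm ℤ L) (a b : ℕ) : Prop :=
  Module.finrank ℤ L = a + b ∧ sigPos (realForm q) = a ∧ sigNeg (realForm q) = b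

/-- The standard topology of the finite-dimensional real vector space `V`. -/
instance : TopologicalSpace (RealSpace L) := moduleTopology ℝ (RealSpace L)

/-- The quotient topology on the projective space of `V`. -/
instance : TopologicalSpace (ℙ ℝ (RealSpace L)) :=
  TopologicalSpace.coinduced
    (fun v : {v : RealSpace L // v ≠ 0} => Projectivization.mk ℝ v.1 v.2) inferInstance

/-- The hyperbolic space `ℍ = ℙ V⁺`: the lines spanned by vectors of positive square. -/
def hyperbolicSpace (q : QuadraticForm ℤ L) : Set (ℙ ℝ (RealSpace L)) :=
  {p | 0 < realForm q p.rep}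

/-- The part `ℍ ∩ ℙ W` of the hyperbolic space lying on a linear subspace `W` of `V`. -/
def hypSubspace (q : QuadraticForm ℤ L) (W : Submodule ℝ (RealSpace L)) :
    Set (ℙ ℝ (RealSpace L)) :=
  {p | p ∈ hyperbolicSpace q ∧ p.rep ∈ W}

/-- The hyperplane `s^⊥` in `V`. -/
def perp (q : QuadraticForm ℤ L) (s : L) : Submodule ℝ (RealSpace L) :=
  LinearMap.ker (realBilin q ((1 : ℝ) ⊗ₜ[ℤ] s))

/-- The intersections of `k` transversal hyperplanes `s₁^⊥, …, s_k^⊥` with all `s_i ∈ S`, where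
transversality means that the normal vectors are linearly independent. -/
def flats (q : QuadraticForm ℤ L) (S : Set L) (k : ℕ) : Set (Submodule ℝ (RealSpace L)) :=
  {W | ∃ s : Fin k → L, (∀ i, s i ∈ S) ∧
    LinearIndependent ℝ (fun i => ((1 : ℝ) ⊗ₜ[ℤ] s i : RealSpace L)) ∧
    W = ⨅ i, perp q (s i)}

/-- The `d`-dimensional faces of the tessellation of the `n`-dimensional hyperbolic space cut out
by the hyperplanes `s^⊥`, `s ∈ S`: the connected components of `S_d` minus the union of all
`S_{d-1}`, where `S_d` is an intersection in `ℍ` of `k = n - d` transversal hyperplanes and the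
`S_{d-1}` are the intersections of `k + 1` transversal ones. For `d = n` these are the
components of `ℍ` minus all the hyperplanes. -/
def faces (q : QuadraticForm ℤ L) (S : Set L) (n d : ℕ) : Set (Set (ℙ ℝ (RealSpace L))) :=
  {F | ∃ k, k + d = n ∧ ∃ W ∈ flats q S k,
    ∃ x ∈ hypSubspace q W \ ⋃ W' ∈ flats q S (k + 1), hypSubspace q W',
      F = connectedComponentIn
        (hypSubspace q W \ ⋃ W' ∈ flats q S (k + 1), hypSubspace q W') x}

/-- The projective transformation of `ℙ V` induced by an automorphism of `L`. -/
def projAct (g : L ≃ₗ[ℤ] L) : ℙ ℝ (RealSpace L) → ℙ ℝ (RealSpace L) :=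
  Projectivization.map (LinearEquiv.baseChange ℤ ℝ L L g).toLinearMap
    (LinearEquiv.baseChange ℤ ℝ L L g).injective

/-- The orbit `Γ · S₀` of a set of vectors. -/
def orbitSet {q : QuadraticForm ℤ L} (Γ : Subgroup (orthogonalGroup q)) (S₀ : Set L) : Set L :=
  {s | ∃ γ ∈ Γ, ∃ s₀ ∈ S₀, s = (γ : L ≃ₗ[ℤ] L) s₀}

end HypTess

end

/-!
A point near a given point `p` of `ℍ` only sees the finitely many walls through `p`, so finitely
many faces have `p` in their closure. Walking inside the stratum of a face until the first wall is
hit, one finds a point of smaller dimension in the closure of the face, unless the face fills the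
whole stratum. By induction on the dimension it is enough to count the faces that fill a stratum,
hence to count strata.

A stratum through a positive vector `x` is the orthogonal complement of linearly independent
`s₁, …, sₖ ∈ S ∩ x^⊥`. As the form is negative definite on `x^⊥` and bounded below on `S`, the Gram
matrix of the `sᵢ` is nondegenerate with entries bounded by Cauchy–Schwarz. Reduction theory shows
that such tuples fall into finitely many orbits: by Minkowski's theorem the orthogonal complement
of the tuple contains a vector whose square is bounded and nonzero, so that the tuple extends to
one of full rank whose Gram matrix is still bounded. A full tuple `t` is determined up to isometry
by its Gram matrix `G` and by the image of the lattice under `y ↦ (b(y, tᵢ))ᵢ`, and there are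
finitely many possibilities for this image because it contains `(det G) ℤᵐ`.

Topology enters only through the description of faces by signs: the set of points with prescribed
signs of the `b(·, s)` is the image of a convex cone, and the sign of a nonvanishing function is
constant on a connected set.
-/

namespace HypTess

section GeometryOfNumbers

open Matrix MeasureTheory

variable {ι : Type*} [Fintype ι] [DecidableEq ι]

/-- Minkowski's theorem, for the lattice spanned by the columns of `P` and the cube of side `2c`. -/
theorem exists_int_norm_mulVec_le {P : Matrix ι ι ℝ} (hP : P.det ≠ 0) {c : ℝ} (hc : 0 ≤ c)
    (hPc : |P.det| < c ^ Fintype.card ι) :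
    ∃ z : ι → ℤ, z ≠ 0 ∧ ‖P *ᵥ fun j => (z j : ℝ)‖ ≤ c := by
  classical
  let b := basisOfPiSpaceOfLinearIndependent (linearIndependent_cols_of_det_ne_zero hP)
  have hb : ⇑b = P.col := coe_basisOfPiSpaceOfLinearIndependent _
  have : Countable (Submodule.span ℤ (Set.range b)).toAddSubgroup :=
    inferInstanceAs (Countable (Submodule.span ℤ (Set.range b)))
  have hvol : volume (ZSpan.fundamentalDomain b) * 2 ^ Module.finrank ℝ (ι → ℝ)
      < volume (Metric.closedBall (0 : ι → ℝ) c) := by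
    have hdet : (Matrix.of b).det = P.det := by rw [hb, ← det_transpose]; rfl
    rw [ZSpan.volume_fundamentalDomain, hdet, Real.volume_pi_closedBall _ hc, Module.finrank_pi,
      ← ENNReal.ofReal_ofNat, ← ENNReal.ofReal_pow two_pos.le, ← ENNReal.ofReal_mul (abs_nonneg _),
      mul_pow, mul_comm]
    have := (abs_nonneg P.det).trans_lt hPc
    exact (ENNReal.ofReal_lt_ofReal_iff (by positivity)).mpr
      (mul_lt_mul_of_pos_left hPc (by positivity))
  obtain ⟨x, hx₀, hxc⟩ := exists_ne_zero_mem_lattice_of_measure_mul_two_pow_lt_measure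
    (ZSpan.isAddFundamentalDomain' b volume) (fun x hx => by simpa using hx)
    (convex_closedBall (0 : ι → ℝ) c) hvol
  obtain ⟨z, hz⟩ := (Submodule.mem_span_range_iff_exists_fun ℤ).mp x.2
  have hPz : P *ᵥ (fun j => (z j : ℝ)) = x := by
    ext i
    simp [← hz, hb, mulVec, dotProduct, mul_comm]
  refine ⟨z, fun h => hx₀ (Subtype.ext ?_), ?_⟩
  · rw [← hz, h]
    simp
  · rw [hPz]
    simpa using hxc

theorem exists_eq_transpose_mul_diagonal_mul {G : Matrix ι ι ℝ} (hG : G.IsHermitian) :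
    ∃ (P : Matrix ι ι ℝ) (w : ι → ℝ), (∀ i, |w i| = 1) ∧ G = Pᵀ * diagonal w * P := by
  let U : Matrix ι ι ℝ := hG.eigenvectorUnitary
  let l : ι → ℝ := hG.eigenvalues
  have hGU : G = U * diagonal l * Uᵀ := by
    have h := hG.spectral_theorem
    rwa [Unitary.conjStarAlgAut_apply, star_eq_conjTranspose,
      conjTranspose_eq_transpose_of_trivial] at h
  refine ⟨diagonal (fun i => √|l i|) * Uᵀ, fun i => if 0 ≤ l i then 1 else -1,
    fun i => by dsimp only; split_ifs <;> simp, ?_⟩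
  have hl : diagonal l = diagonal (fun i => √|l i|) *
      diagonal (fun i => if 0 ≤ l i then 1 else -1) * diagonal (fun i => √|l i|) := by
    rw [diagonal_mul_diagonal, diagonal_mul_diagonal]
    congr with i
    rw [mul_right_comm, Real.mul_self_sqrt (abs_nonneg _)]
    split_ifs with h
    · rw [abs_of_nonneg h, mul_one]
    · rw [abs_of_neg (not_le.mp h), mul_neg_one, neg_neg]
  rw [transpose_mul, transpose_transpose, diagonal_transpose, hGU]
  conv_lhs => rw [hl]
  simp only [Matrix.mul_assoc]

theorem exists_int_form_le [Nonempty ι] {G : Matrix ι ι ℝ} (hG : G.IsHermitian)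
    (hdet : G.det ≠ 0) :
    ∃ z : ι → ℤ, z ≠ 0 ∧
      |(fun j => (z j : ℝ)) ⬝ᵥ G *ᵥ fun j => (z j : ℝ)| ≤ Fintype.card ι * (|G.det| + 1) ^ 2 := by
  obtain ⟨P, w, hw, hP⟩ := exists_eq_transpose_mul_diagonal_mul hG
  have hsq : |P.det| ^ 2 = |G.det| := by
    rw [hP, det_mul, det_mul, det_transpose, det_diagonal, abs_mul, abs_mul, Finset.abs_prod]
    simp [hw, sq]
  have hP₀ : P.det ≠ 0 := by
    intro h
    exact hdet (by simpa [h, eq_comm] using hsq)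
  have hlt : |P.det| < (|G.det| + 1) ^ Fintype.card ι :=
    calc |P.det| < |G.det| + 1 := by nlinarith [sq_nonneg (|P.det| - 1)]
      _ ≤ _ := le_self_pow₀ (by linarith [abs_nonneg G.det]) Fintype.card_ne_zero
  obtain ⟨z, hz₀, hz⟩ := exists_int_norm_mulVec_le hP₀ (by positivity) hlt
  refine ⟨z, hz₀, ?_⟩
  set y := P *ᵥ fun j => (z j : ℝ)
  have hval : (fun j => (z j : ℝ)) ⬝ᵥ G *ᵥ (fun j => (z j : ℝ)) = ∑ i, w i * y i ^ 2 := by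
    rw [hP, ← mulVec_mulVec, ← mulVec_mulVec, dotProduct_mulVec, vecMul_transpose]
    simp only [dotProduct, mulVec_diagonal]
    exact Finset.sum_congr rfl fun i _ => by ring
  rw [hval]
  calc |∑ i, w i * y i ^ 2| ≤ ∑ i, |w i * y i ^ 2| := Finset.abs_sum_le_sum_abs _ _
    _ = ∑ i, ‖y i‖ ^ 2 := by simp only [abs_mul, hw, one_mul, abs_pow, Real.norm_eq_abs]
    _ ≤ ∑ _i : ι, (|G.det| + 1) ^ 2 :=
        Finset.sum_le_sum fun i _ => by gcongr; exact (norm_le_pi_norm y i).trans hz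
    _ = _ := by simp

end GeometryOfNumbers

section Gram

open Matrix

variable {R M ι : Type*} [CommRing R] [AddCommGroup M] [Module R M]

/-- The Gram matrix of a tuple of vectors with respect to a bilinear form over a commutative
ring. -/
def gram (b : LinearMap.BilinForm R M) (s : ι → M) : Matrix ι ι R :=
  Matrix.of fun i j => b (s i) (s j)

@[simp]
theorem gram_apply (b : LinearMap.BilinForm R M) (s : ι → M) (i j : ι) :
    gram b s i j = b (s i) (s j) :=
  rfl

/-- The linear map `x ↦ (b x (s i))ᵢ`, whose kernel is the orthogonal complement of the tuple
`s`. -/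
def pairing (b : LinearMap.BilinForm R M) (s : ι → M) : M →ₗ[R] ι → R :=
  LinearMap.pi fun i => b.flip (s i)

@[simp]
theorem pairing_apply (b : LinearMap.BilinForm R M) (s : ι → M) (x : M) (i : ι) :
    pairing b s x i = b x (s i) :=
  rfl

/-- `E` annihilates the discriminant group `M* / M` of `b`: the multiple `E • f` of every linear
functional `f` is represented by a vector of `M`. -/
def AnnihilatesDiscriminant (b : LinearMap.BilinForm R M) (E : R) : Prop :=
  ∀ f : Module.Dual R M, E • f ∈ LinearMap.range b

variable {b : LinearMap.BilinForm R M}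

theorem det_gram_cons {k : ℕ} {s : Fin k → M} {v : M} (hv : pairing b s v = 0) :
    (gram b (Fin.cons v s : Fin (k + 1) → M)).det = b v v * (gram b s).det := by
  have hvs : ∀ i, b v (s i) = 0 := congrFun hv
  rw [det_succ_row_zero, Fin.sum_univ_succ]
  simp [hvs]
  rfl

variable [Fintype ι]

theorem bilin_sum_smul (b : LinearMap.BilinForm R M) (z w : ι → R) (s : ι → M) :
    b (∑ i, z i • s i) (∑ i, w i • s i) = z ⬝ᵥ gram b s *ᵥ w := by
  simp only [map_sum, LinearMap.sum_apply, dotProduct, mulVec, Finset.mul_sum, map_smul,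
    LinearMap.smul_apply, gram_apply, smul_eq_mul]
  rw [Finset.sum_comm]
  exact Finset.sum_congr rfl fun i _ => Finset.sum_congr rfl fun j _ => by ring

theorem pairing_sum_smul (b : LinearMap.BilinForm R M) (c : ι → R) (s : ι → M) :
    pairing b s (∑ i, c i • s i) = c ᵥ* gram b s := by
  ext j
  simp [vecMul, dotProduct]

variable [DecidableEq ι]

theorem exists_pairing_sum_smul_eq (b : LinearMap.BilinForm R M) (s : ι → M) (y : ι → R) :
    ∃ c : ι → R, pairing b s (∑ i, c i • s i) = (gram b s).det • y :=
  ⟨y ᵥ* (gram b s).adjugate, by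
    rw [pairing_sum_smul, vecMul_vecMul, adjugate_mul, vecMul_smul, vecMul_one]⟩

theorem det_gram_smul_mem_range_pairing (b : LinearMap.BilinForm R M) (s : ι → M) (y : ι → R) :
    (gram b s).det • y ∈ LinearMap.range (pairing b s) :=
  let ⟨_, hc⟩ := exists_pairing_sum_smul_eq b s y
  ⟨_, hc⟩

theorem exists_det_gram_smul_sub_mem_ker_pairing (b : LinearMap.BilinForm R M) (s : ι → M)
    (x : M) : ∃ c : ι → R,
      (gram b s).det • x - ∑ i, c i • s i ∈ LinearMap.ker (pairing b s) := by
  obtain ⟨c, hc⟩ := exists_pairing_sum_smul_eq b s (pairing b s x)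
  exact ⟨c, by rw [LinearMap.mem_ker, map_sub, map_smul, hc, sub_self]⟩

theorem annihilatesDiscriminant_det_gram (e : Module.Basis ι R M) :
    AnnihilatesDiscriminant b (gram b e).det := by
  intro f
  obtain ⟨u, hu⟩ := det_gram_smul_mem_range_pairing b e (f ∘ e)
  exact ⟨u, e.ext (congrFun hu)⟩

theorem AnnihilatesDiscriminant.det_gram_dvd {E : R} (h : AnnihilatesDiscriminant b E)
    (e : Module.Basis ι R M) : (gram b e).det ∣ E ^ Fintype.card ι := by
  choose u hu using fun i => h (e.coord i)
  have hmul : Matrix.of (fun i j => e.repr (u i) j) * gram b e = E • (1 : Matrix ι ι R) := by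
    ext i k
    have hrow : ⇑(e.repr (u i)) ᵥ* gram b e = pairing b e (u i) := by
      rw [← pairing_sum_smul, e.sum_repr]
    calc _ = (⇑(e.repr (u i)) ᵥ* gram b e) k := rfl
      _ = (E • e.coord i) (e k) := by rw [hrow, pairing_apply, hu]
      _ = _ := by simp [one_apply, Finsupp.single_apply, eq_comm]
  have hdet := congrArg Matrix.det hmul
  rw [det_mul, det_smul, det_one, mul_one] at hdet
  exact Dvd.intro_left _ hdet

variable [IsDomain R]

theorem pairing_injective [Module.Free R M] [Module.Finite R M] {t : ι → M}
    (hcard : Module.finrank R M = Fintype.card ι) (ht : (gram b t).det ≠ 0) :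
    Function.Injective (pairing b t) := by
  let F : (ι → R) →ₗ[R] LinearMap.range (pairing b t) :=
    (pairing b t).rangeRestrict ∘ₗ Fintype.linearCombination R t
  have hF : Function.Injective F := by
    intro c c' h
    have h' : pairing b t (∑ i, c i • t i) = pairing b t (∑ i, c' i • t i) := congrArg Subtype.val h
    rw [pairing_sum_smul, pairing_sum_smul] at h'
    exact sub_eq_zero.mp (eq_zero_of_vecMul_eq_zero ht (by rw [sub_vecMul, h', sub_self]))
  refine LinearMap.ker_eq_bot.mp (top_disjoint.mp (Submodule.disjoint_ker_of_finrank_le _ ?_))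
  rw [finrank_top, Submodule.map_top, hcard, ← Module.finrank_pi R]
  exact LinearMap.finrank_le_finrank_of_injective hF

theorem exists_isometry [Module.Free R M] [Module.Finite R M] {t t' : ι → M}
    (hcard : Module.finrank R M = Fintype.card ι) (ht : (gram b t).det ≠ 0)
    (hgram : gram b t = gram b t')
    (hrange : LinearMap.range (pairing b t) = LinearMap.range (pairing b t')) :
    ∃ g : M ≃ₗ[R] M, (∀ x y, b (g x) (g y) = b x y) ∧ ∀ i, g (t i) = t' i := by
  have hinj := pairing_injective hcard ht
  have hinj' := pairing_injective hcard (hgram ▸ ht)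
  let g : M ≃ₗ[R] M := (LinearEquiv.ofInjective _ hinj).trans
    ((LinearEquiv.ofEq _ _ hrange).trans (LinearEquiv.ofInjective _ hinj').symm)
  have hg : ∀ x, pairing b t' (g x) = pairing b t x := fun x =>
    congrArg Subtype.val ((LinearEquiv.ofInjective _ hinj').apply_symm_apply _)
  have hgt : ∀ i, g (t i) = t' i := fun i => hinj' <| by
    rw [hg]
    exact congrFun hgram i
  refine ⟨g, fun x y => mul_left_cancel₀ ht ?_, hgt⟩
  obtain ⟨c, hc⟩ := exists_det_gram_smul_sub_mem_ker_pairing b t y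
  have hy : (gram b t).det • y = ∑ i, c i • t i :=
    sub_eq_zero.mp (hinj (hc.trans (map_zero _).symm))
  have hgx : ∀ i, b (g x) (t' i) = b x (t i) := congrFun (hg x)
  rw [← smul_eq_mul, ← smul_eq_mul, ← map_smul, ← map_smul, ← map_smul (b x), hy]
  simp only [map_sum, map_smul, hgt, hgx]

end Gram

section PrincipalIdealDomain

variable {R M N : Type*} [CommRing R] [IsDomain R] [IsPrincipalIdealRing R] [AddCommGroup M]
  [Module R M]

theorem exists_dual_extension_of_ker [AddCommGroup N] [Module R N] [Module.Free R N]
    [Module.Finite R N] (φ : M →ₗ[R] N) (f : Module.Dual R (LinearMap.ker φ)) :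
    ∃ F : Module.Dual R M, ∀ x : LinearMap.ker φ, F x = f x := by
  obtain ⟨σ, hσ⟩ := φ.rangeRestrict.exists_rightInverse_of_surjective φ.range_rangeRestrict
  have hφσ : ∀ y, φ (σ y) = y := fun y => congrArg Subtype.val (LinearMap.congr_fun hσ y)
  let r : M →ₗ[R] LinearMap.ker φ :=
    LinearMap.codRestrict _ (LinearMap.id - σ ∘ₗ φ.rangeRestrict) fun x => by simp [hφσ]
  refine ⟨f ∘ₗ r, fun x => congrArg f (Subtype.ext ?_)⟩
  have hx : φ.rangeRestrict x = 0 := Subtype.ext x.2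
  simp [r, hx]

theorem AnnihilatesDiscriminant.restrict_ker_pairing {b : LinearMap.BilinForm R M} (hb : b.IsSymm)
    {E : R} (h : AnnihilatesDiscriminant b E) {ι : Type*} [Fintype ι] [DecidableEq ι]
    (s : ι → M) :
    AnnihilatesDiscriminant (b.restrict (LinearMap.ker (pairing b s))) ((gram b s).det * E) := by
  intro f
  obtain ⟨F, hF⟩ := exists_dual_extension_of_ker (pairing b s) f
  obtain ⟨u, hu⟩ := h F
  obtain ⟨c, hc⟩ := exists_det_gram_smul_sub_mem_ker_pairing b s u
  refine ⟨⟨_, hc⟩, LinearMap.ext fun x => ?_⟩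
  have hsx : ∀ i, b (s i) x = 0 := fun i => (hb.eq _ _).trans (congrFun x.2 i)
  have hux : b u x = E * f x := by
    rw [← hF]
    exact LinearMap.congr_fun hu x
  simp [hsx, hux, mul_assoc]

theorem exists_eq_smul_primitive [Module.Free R M] [Module.Finite R M] {z : M} (hz : z ≠ 0) :
    ∃ (g : R) (v : M) (f : Module.Dual R M), z = g • v ∧ f v = 1 := by
  let e := Module.Free.chooseBasis R M
  obtain ⟨g, hg⟩ := IsPrincipalIdealRing.principal (LinearMap.range (Module.Dual.eval R M z))
  have hdvd : ∀ i, ∃ c, c * g = e.repr z i := fun i =>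
    Submodule.mem_span_singleton.mp (hg ▸ ⟨e.coord i, rfl⟩)
  choose w hw using hdvd
  have hzv : z = g • ∑ i, w i • e i := by
    rw [Finset.smul_sum, ← e.sum_repr z]
    simp [smul_smul, mul_comm g, hw]
  obtain ⟨f, hf⟩ : g ∈ LinearMap.range (Module.Dual.eval R M z) :=
    hg ▸ Submodule.mem_span_singleton_self g
  have hg₀ : g ≠ 0 := by
    rintro rfl
    exact hz (by rw [hzv, zero_smul])
  refine ⟨g, ∑ i, w i • e i, f, hzv, mul_left_cancel₀ hg₀ ?_⟩
  rw [← smul_eq_mul, ← map_smul, ← hzv, mul_one]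
  exact hf

end PrincipalIdealDomain

section IntegralForms

variable {M : Type*} [AddCommGroup M] {b : LinearMap.BilinForm ℤ M}

theorem exists_add_smul_isotropic (hb : b.IsSymm) {u v : M} (hv : b v v = 0) (huv : b u v ≠ 0) :
    ∃ c : ℤ, 0 < b (u + c • v) (u + c • v) ∧ b (u + c • v) (u + c • v) ≤ 2 * |b u v| := by
  have hval : ∀ c : ℤ, b (u + c • v) (u + c • v) = b u u + 2 * b u v * c := fun c => by
    simp only [map_add, LinearMap.add_apply, map_smul, LinearMap.smul_apply, smul_eq_mul, hv,
      ← hb.eq u v]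
    ring
  have hmod := Int.mul_ediv_add_emod (b u u - 1) (2 * b u v)
  have hnonneg := Int.emod_nonneg (b u u - 1) (mul_ne_zero two_ne_zero huv)
  have hlt := Int.emod_lt_abs (b u u - 1) (mul_ne_zero two_ne_zero huv)
  rw [abs_mul, abs_two] at hlt
  refine ⟨-((b u u - 1) / (2 * b u v)), ?_⟩
  rw [hval, mul_neg]
  constructor <;> linarith

theorem finite_submodules_forall_smul_mem [Module.Finite ℤ M] {N : ℤ} (hN : N ≠ 0) :
    {Λ : Submodule ℤ M | ∀ x, N • x ∈ Λ}.Finite := by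
  let K := LinearMap.range (LinearMap.lsmul ℤ M N)
  have htors : Module.IsTorsion ℤ (M ⧸ K) := by
    rintro ⟨x⟩
    exact ⟨⟨N, mem_nonZeroDivisors_of_ne_zero hN⟩,
      (Submodule.Quotient.mk_eq_zero K).mpr ⟨x, rfl⟩⟩
  have : Finite (M ⧸ K) := Module.finite_of_fg_torsion _ htors
  refine Set.Finite.of_finite_image (f := Submodule.map K.mkQ) (Set.toFinite _) ?_
  intro Λ hΛ Λ' hΛ' heq
  have hle : ∀ {Λ : Submodule ℤ M}, (∀ x, N • x ∈ Λ) → K ≤ Λ := by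
    rintro Λ hΛ _ ⟨x, rfl⟩
    exact hΛ x
  have := congrArg (Submodule.comap K.mkQ) heq
  rwa [Submodule.comap_map_mkQ, Submodule.comap_map_mkQ, sup_eq_right.mpr (hle hΛ),
    sup_eq_right.mpr (hle hΛ')] at this

variable [Module.Free ℤ M] [Module.Finite ℤ M]

open Matrix in
theorem AnnihilatesDiscriminant.exists_ne_zero_abs_le [Nontrivial M] (hb : b.IsSymm) {E : ℤ}
    (hE : E ≠ 0) (h : AnnihilatesDiscriminant b E) :
    ∃ z : M, z ≠ 0 ∧
      |b z z| ≤ Module.finrank ℤ M * (|E| ^ Module.finrank ℤ M + 1) ^ 2 := by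
  classical
  let e := Module.Free.chooseBasis ℤ M
  have hcard := Module.finrank_eq_card_chooseBasisIndex ℤ M
  have hdvd := h.det_gram_dvd e
  rw [← hcard] at hdvd
  have hdet₀ : (gram b e).det ≠ 0 := ne_zero_of_dvd_ne_zero (pow_ne_zero _ hE) hdvd
  have hdet : |(gram b e).det| ≤ |E| ^ Module.finrank ℤ M := by
    rw [← abs_pow]
    exact Int.le_of_dvd (abs_pos.mpr (pow_ne_zero _ hE)) ((abs_dvd_abs _ _).mpr hdvd)
  have := e.index_nonempty
  let G : Matrix _ _ ℝ := (gram b e).map (Int.castRingHom ℝ)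
  have hG : G.IsHermitian := by
    ext i j
    simp [G, ← hb.eq (e i) (e j)]
  have hGdet : G.det = ((gram b e).det : ℝ) := ((Int.castRingHom ℝ).map_det (gram b e)).symm
  obtain ⟨z, hz₀, hz⟩ := exists_int_form_le hG (by rw [hGdet]; exact_mod_cast hdet₀)
  have hval : (fun j => (z j : ℝ)) ⬝ᵥ G *ᵥ (fun j => (z j : ℝ))
      = (b (∑ i, z i • e i) (∑ i, z i • e i) : ℤ) := by
    rw [bilin_sum_smul]
    simp [dotProduct, mulVec, G]
  rw [hval, hGdet, ← hcard] at hz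
  refine ⟨∑ i, z i • e i, fun h₀ => hz₀ (funext ?_), ?_⟩
  · exact Fintype.linearIndependent_iff.mp e.linearIndependent z h₀
  · calc |b (∑ i, z i • e i) (∑ i, z i • e i)|
        ≤ Module.finrank ℤ M * (|(gram b e).det| + 1) ^ 2 := by exact_mod_cast hz
      _ ≤ _ := by gcongr

theorem AnnihilatesDiscriminant.exists_nonisotropic_abs_le [Nontrivial M] (hb : b.IsSymm) {E : ℤ}
    (hE : E ≠ 0) (h : AnnihilatesDiscriminant b E) :
    ∃ v : M, b v v ≠ 0 ∧
      |b v v| ≤ Module.finrank ℤ M * (|E| ^ Module.finrank ℤ M + 1) ^ 2 + 2 * |E| := by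
  obtain ⟨z, hz₀, hz⟩ := h.exists_ne_zero_abs_le hb hE
  by_cases hzz : b z z = 0
  · obtain ⟨g, v, f, rfl, hfv⟩ := exists_eq_smul_primitive (R := ℤ) hz₀
    have hg : g ≠ 0 := left_ne_zero_of_smul hz₀
    have hvv : b v v = 0 := by simpa [hg] using hzz
    obtain ⟨u, hu⟩ := h f
    have huv : b u v = E := by rw [hu, LinearMap.smul_apply, hfv, smul_eq_mul, mul_one]
    obtain ⟨c, hpos, hle⟩ := exists_add_smul_isotropic hb hvv (huv ▸ hE)
    rw [huv] at hle
    refine ⟨u + c • v, hpos.ne', ?_⟩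
    rw [abs_of_pos hpos]
    exact hle.trans (le_add_of_nonneg_left (by positivity))
  · exact ⟨z, hzz, hz.trans (le_add_of_nonneg_right (by positivity))⟩

theorem exists_nonisotropic_mem_ker_pairing (hb : b.IsSymm) {D : ℤ} (hD : D ≠ 0)
    (h : AnnihilatesDiscriminant b D) {k : ℕ} (hk : k < Module.finrank ℤ M) (N : ℤ) :
    ∃ N' : ℤ, ∀ s : Fin k → M, (gram b s).det ≠ 0 → (∀ i j, |b (s i) (s j)| ≤ N) →
      ∃ v : M, pairing b s v = 0 ∧ b v v ≠ 0 ∧ |b v v| ≤ N' := by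
  let F : ℤ := k.factorial • N ^ k * |D|
  refine ⟨Module.finrank ℤ M * (F ^ Module.finrank ℤ M + 1) ^ 2 + 2 * F, fun s hs hN => ?_⟩
  let K := LinearMap.ker (pairing b s)
  have hE : (gram b s).det * D ≠ 0 := mul_ne_zero hs hD
  have hEF : |(gram b s).det * D| ≤ F := by
    have hdet : |(gram b s).det| ≤ k.factorial • N ^ k := by
      simpa using Matrix.det_le (A := gram b s) (abv := AbsoluteValue.abs) hN
    rw [abs_mul]
    exact mul_le_mul_of_nonneg_right hdet (abs_nonneg D)
  have hK : Nontrivial K := by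
    rw [Submodule.nontrivial_iff_ne_bot]
    intro hbot
    have := LinearMap.finrank_le_finrank_of_injective (LinearMap.ker_eq_bot.mp hbot)
    rw [Module.finrank_pi, Fintype.card_fin] at this
    omega
  obtain ⟨v, hv₀, hv⟩ := (h.restrict_ker_pairing hb s).exists_nonisotropic_abs_le
    (b := b.restrict K) ⟨fun x y => hb.eq x y⟩ hE
  have hrank : Module.finrank ℤ K ≤ Module.finrank ℤ M := K.finrank_le
  have hpow : |(gram b s).det * D| ^ Module.finrank ℤ K ≤ F ^ Module.finrank ℤ M :=
    (pow_le_pow_right₀ (Int.one_le_abs hE) hrank).trans (by gcongr)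
  refine ⟨v, v.2, hv₀, hv.trans ?_⟩
  gcongr

theorem exists_extension_to_full_rank (hb : b.IsSymm) {D : ℤ} (hD : D ≠ 0)
    (h : AnnihilatesDiscriminant b D) {k : ℕ} (hk : k ≤ Module.finrank ℤ M) (N : ℤ) :
    ∃ (N' : ℤ) (f : Fin k → Fin (Module.finrank ℤ M)), ∀ s : Fin k → M, (gram b s).det ≠ 0 →
      (∀ i j, |b (s i) (s j)| ≤ N) → ∃ t : Fin (Module.finrank ℤ M) → M,
        (gram b t).det ≠ 0 ∧ (∀ i j, |b (t i) (t j)| ≤ N') ∧ t ∘ f = s := by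
  induction hk using Nat.decreasingInduction generalizing N with
  | self => exact ⟨N, id, fun s hs hN => ⟨s, hs, hN, rfl⟩⟩
  | of_succ k hk ih =>
    obtain ⟨N₁, hN₁⟩ := exists_nonisotropic_mem_ker_pairing hb hD h hk N
    obtain ⟨N', f, hf⟩ := ih (max (max N N₁) 0)
    refine ⟨N', f ∘ Fin.succ, fun s hs hN => ?_⟩
    obtain ⟨v, hv, hv₀, hvN⟩ := hN₁ s hs hN
    have hvs : ∀ i, b v (s i) = 0 := congrFun hv
    obtain ⟨t, ht₀, htN, ht⟩ := hf (Fin.cons v s)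
      (by rw [det_gram_cons hv]; exact mul_ne_zero hv₀ hs) (by
        refine Fin.cases (Fin.cases ?_ fun j => ?_) fun i => Fin.cases ?_ fun j => ?_
        · exact hvN.trans ((le_max_right _ _).trans (le_max_left _ _))
        · simp [hvs]
        · simp [← hb.eq v, hvs]
        · exact (hN i j).trans ((le_max_left _ _).trans (le_max_left _ _)))
    exact ⟨t, ht₀, htN, by rw [← Function.comp_assoc, ht]; rfl⟩

end IntegralForms

section FiniteOrbits

theorem exists_finite_representatives_of_finiteIndex {G α : Type*} [Group G] [MulAction G α]
    (H : Subgroup G) [H.FiniteIndex] {X R : Set α} (hR : R.Finite)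
    (hX : ∀ x ∈ X, ∃ r ∈ R, ∃ g : G, x = g • r) :
    ∃ R' : Set α, R'.Finite ∧ ∀ x ∈ X, ∃ r ∈ R', ∃ h ∈ H, x = h • r := by
  obtain ⟨T, hT, -⟩ := H.exists_isComplement_right 1
  refine ⟨Set.image2 (· • ·) T R, hT.finite_right.image2 _ hR, fun x hx => ?_⟩
  obtain ⟨r, hr, g, rfl⟩ := hX x hx
  obtain ⟨⟨h, t⟩, rfl⟩ := hT.2 g
  exact ⟨t.1 • r, ⟨t, t.2, r, hr, rfl⟩, h, h.2, mul_smul _ _ _⟩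

theorem finite_bounded_matrix_prod_submodule (m : ℕ) (N : ℤ) :
    {p : Matrix (Fin m) (Fin m) ℤ × Submodule ℤ (Fin m → ℤ) |
      (∀ i j, |p.1 i j| ≤ N) ∧ p.1.det ≠ 0 ∧ ∀ x, p.1.det • x ∈ p.2}.Finite := by
  have hfin : {A : Matrix (Fin m) (Fin m) ℤ | (∀ i j, |A i j| ≤ N) ∧ A.det ≠ 0}.Finite := by
    have hpi : {A : Matrix (Fin m) (Fin m) ℤ | ∀ i j, A i j ∈ Set.Icc (-N) N}.Finite :=
      Set.Finite.pi' fun i => Set.Finite.pi' fun j => Set.finite_Icc _ _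
    exact hpi.subset fun A hA i j => abs_le.mp (hA.1 i j)
  refine (hfin.biUnion fun A hA => (Set.finite_singleton A).prod
    (finite_submodules_forall_smul_mem hA.2)).subset ?_
  rintro ⟨A, Λ⟩ ⟨hN, hdet, hΛ⟩
  exact Set.mem_biUnion (x := A) ⟨hN, hdet⟩ ⟨rfl, hΛ⟩

theorem exists_finite_tuples_isometry {M : Type*} [AddCommGroup M] [Module.Free ℤ M]
    [Module.Finite ℤ M] {b : LinearMap.BilinForm ℤ M} (hb : b.IsSymm) {D : ℤ} (hD : D ≠ 0)
    (h : AnnihilatesDiscriminant b D) {k : ℕ} (hk : k ≤ Module.finrank ℤ M) (N : ℤ) :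
    ∃ R : Set (Fin k → M), R.Finite ∧ ∀ s : Fin k → M, (gram b s).det ≠ 0 →
      (∀ i j, |b (s i) (s j)| ≤ N) →
      ∃ r ∈ R, ∃ g : M ≃ₗ[ℤ] M, (∀ x y, b (g x) (g y) = b x y) ∧ s = g ∘ r := by
  obtain ⟨N', f, hext⟩ := exists_extension_to_full_rank hb hD h hk N
  choose! t ht₀ htN hts using hext
  let X : Set (Fin k → M) := {s | (gram b s).det ≠ 0 ∧ ∀ i j, |b (s i) (s j)| ≤ N}
  let inv := fun s => (gram b (t s), LinearMap.range (pairing b (t s)))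
  have hfin : (inv '' X).Finite := by
    refine (finite_bounded_matrix_prod_submodule _ N').subset ?_
    rintro _ ⟨s, ⟨hs₀, hsN⟩, rfl⟩
    exact ⟨htN s hs₀ hsN, ht₀ s hs₀ hsN, det_gram_smul_mem_range_pairing b (t s)⟩
  obtain ⟨R, hRX, hR⟩ := Set.exists_subset_bijOn X inv
  refine ⟨R, Set.Finite.of_finite_image (hR.image_eq ▸ hfin) hR.injOn, fun s hs₀ hsN => ?_⟩
  obtain ⟨r, hr, hrs⟩ : inv s ∈ inv '' R := hR.image_eq ▸ ⟨s, ⟨hs₀, hsN⟩, rfl⟩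
  obtain ⟨hr₀, hrN⟩ := hRX hr
  obtain ⟨g, hg, hgt⟩ := exists_isometry (Fintype.card_fin _).symm (ht₀ r hr₀ hrN)
    (congrArg Prod.fst hrs) (congrArg Prod.snd hrs)
  refine ⟨r, hr, g, hg, ?_⟩
  rw [← hts s hs₀ hsN, ← hts r hr₀ hrN, ← Function.comp_assoc]
  exact congrArg (· ∘ f) (funext hgt).symm

theorem isSymm_polarBilin {M : Type*} [AddCommGroup M] (q : QuadraticForm ℤ M) :
    LinearMap.BilinForm.IsSymm q.polarBilin :=
  ⟨fun x y => QuadraticMap.polar_comm q x y⟩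

theorem exists_finite_tuples_of_finiteIndex {M : Type*} [AddCommGroup M] [Module.Free ℤ M]
    [Module.Finite ℤ M] {q : QuadraticForm ℤ M} {D : ℤ} (hD : D ≠ 0)
    (h : AnnihilatesDiscriminant q.polarBilin D) (Γ : Subgroup (orthogonalGroup q))
    [Γ.FiniteIndex] {k : ℕ} (hk : k ≤ Module.finrank ℤ M) (N : ℤ) :
    ∃ R : Set (Fin k → M), R.Finite ∧ ∀ s : Fin k → M, (gram q.polarBilin s).det ≠ 0 →
      (∀ i j, |q.polarBilin (s i) (s j)| ≤ N) →
      ∃ r ∈ R, ∃ γ ∈ Γ, s = (γ : M ≃ₗ[ℤ] M) ∘ r := by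
  obtain ⟨R, hR, hrep⟩ := exists_finite_tuples_isometry (isSymm_polarBilin q) hD h hk N
  obtain ⟨R', hR', hrep'⟩ := exists_finite_representatives_of_finiteIndex Γ
    (X := {s : Fin k → M | (gram q.polarBilin s).det ≠ 0 ∧
      ∀ i j, |q.polarBilin (s i) (s j)| ≤ N}) hR (by
    rintro s ⟨hs₀, hsN⟩
    obtain ⟨r, hr, g, hg, hs⟩ := hrep s hs₀ hsN
    have hgq : g ∈ orthogonalGroup q := fun v => by simpa using hg v v
    exact ⟨r, hr, ⟨g, hgq⟩, hs⟩)
  exact ⟨R', hR', fun s hs₀ hsN => hrep' s ⟨hs₀, hsN⟩⟩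

end FiniteOrbits

section LorentzianForms

variable {V : Type*} [AddCommGroup V] [Module ℝ V] {B : LinearMap.BilinForm ℝ V}

/-- A symmetric bilinear form that is negative definite on the orthogonal complement of every
vector of positive square. For nondegenerate forms in finite dimension this means signature
`(1, n)` or negative definiteness. -/
structure IsLorentzian (B : LinearMap.BilinForm ℝ V) : Prop where
  symm : ∀ x y, B x y = B y x
  neg_of_perp : ∀ x y, 0 < B x x → B x y = 0 → y ≠ 0 → B y y < 0

namespace IsLorentzian

theorem nonpos_of_perp (h : IsLorentzian B) {x y : V} (hx : 0 < B x x) (hxy : B x y = 0) :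
    B y y ≤ 0 := by
  rcases eq_or_ne y 0 with rfl | hy
  · simp
  · exact (h.neg_of_perp x y hx hxy hy).le

theorem apply_ne_zero (h : IsLorentzian B) {x y : V} (hx : 0 < B x x) (hy : 0 < B y y) :
    B x y ≠ 0 :=
  fun hxy => (h.nonpos_of_perp hx hxy).not_gt hy

theorem apply_mul_apply_le_sq (h : IsLorentzian B) {x : V} (hx : 0 < B x x) (v : V) :
    B x x * B v v ≤ B x v ^ 2 := by
  have hperp := h.nonpos_of_perp (y := B x x • v - B x v • x) hx (by simp [mul_comm])
  simp only [map_sub, map_smul, LinearMap.sub_apply, LinearMap.smul_apply, smul_eq_mul,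
    h.symm v x] at hperp
  nlinarith

theorem sq_apply_le_of_perp (h : IsLorentzian B) {x u v : V} (hx : 0 < B x x) (hu : B x u = 0)
    (hv : B x v = 0) : B u v ^ 2 ≤ B u u * B v v := by
  rcases eq_or_ne v 0 with rfl | hv0
  · simp
  have hvv := h.neg_of_perp x v hx hv hv0
  have hperp := h.nonpos_of_perp (y := B v v • u - B u v • v) hx (by simp [hu, hv])
  simp only [map_sub, map_smul, LinearMap.sub_apply, LinearMap.smul_apply, smul_eq_mul,
    h.symm v u] at hperp
  nlinarith

/-- Two positive vectors lie in the same half of the cone of positive vectors exactly when their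
product is positive, so this says that there are only two halves. -/
theorem sign_apply_mul_sign_apply (h : IsLorentzian B) {x y z : V} (hx : 0 < B x x)
    (hy : 0 < B y y) (hz : 0 < B z z) :
    SignType.sign (B x y) * SignType.sign (B y z) = SignType.sign (B x z) := by
  have hperp := h.nonpos_of_perp (y := B y z • x - B x y • z) hy
    (by simp [h.symm y x, mul_comm])
  simp only [map_sub, map_smul, LinearMap.sub_apply, LinearMap.smul_apply, smul_eq_mul,
    h.symm z x] at hperp
  have hpos : 0 < B x y * B y z * B x z := by
    have hyz := mul_pos (pow_pos (abs_pos.mpr (h.apply_ne_zero hy hz)) 2) hx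
    have hxy := mul_pos (pow_pos (abs_pos.mpr (h.apply_ne_zero hx hy)) 2) hz
    rw [sq_abs] at hyz hxy
    nlinarith
  rw [← sign_mul]
  rcases pos_and_pos_or_neg_and_neg_of_mul_pos hpos with ⟨h₁, h₂⟩ | ⟨h₁, h₂⟩
  · rw [sign_pos h₁, sign_pos h₂]
  · rw [sign_neg h₁, sign_neg h₂]

theorem gram_nonneg (h : IsLorentzian B) {x : V} (hx : 0 < B x x) (y a : V) :
    B y y * B x a ^ 2 - 2 * B x y * B x a * B y a + B x x * B y a ^ 2
      ≤ -B a a * (B x y ^ 2 - B x x * B y y) := by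
  have hcs := h.sq_apply_le_of_perp (u := B x x • y - B x y • x) (v := B x x • a - B x a • x) hx
    (by simp [mul_comm]) (by simp [mul_comm])
  simp only [map_sub, map_smul, LinearMap.sub_apply, LinearMap.smul_apply, smul_eq_mul,
    h.symm y x, h.symm a x] at hcs
  have hscaled : 0 ≤ B x x ^ 3 * (-B a a * (B x y ^ 2 - B x x * B y y) -
      (B y y * B x a ^ 2 - 2 * B x y * B x a * B y a + B x x * B y a ^ 2)) := by
    linarith
  linarith [nonneg_of_mul_nonneg_right hscaled (by positivity)]

/-- `B x a` measures the distance from `x` to `a^⊥`, so only finitely many of the hyperplanes given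
by lattice vectors `a` of bounded square cut a given segment. -/
theorem mul_sq_apply_le_of_separates (h : IsLorentzian B) {x y a : V} (hx : 0 < B x x)
    (hxy : 0 < B x y) (ha : B x a * B y a ≤ 0) :
    B y y * B x a ^ 2 ≤ -B a a * (B x y ^ 2 - B x x * B y y) := by
  have hgram := h.gram_nonneg hx y a
  have hy : 0 ≤ B x x * B y a ^ 2 := by positivity
  nlinarith [mul_nonneg hxy.le (neg_nonneg.mpr ha)]

theorem apply_self_pos_of_convex_combination (h : IsLorentzian B) {x y : V} (hx : 0 < B x x)
    (hy : 0 < B y y) (hxy : 0 < B x y) {a c : ℝ} (ha : 0 ≤ a) (hc : 0 ≤ c) (hac : a + c = 1) :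
    0 < B (a • x + c • y) (a • x + c • y) := by
  simp only [map_add, map_smul, LinearMap.add_apply, LinearMap.smul_apply, smul_eq_mul,
    h.symm y x]
  rcases ha.eq_or_lt with rfl | ha
  · obtain rfl : c = 1 := by linarith
    linarith
  · nlinarith [mul_pos (mul_pos ha ha) hx, mul_nonneg (mul_nonneg hc hc) hy.le,
      mul_nonneg (mul_nonneg ha.le hc) hxy.le]

theorem eq_zero_of_forall_apply_eq_zero (h : IsLorentzian B) {x : V} (hx : 0 < B x x) {u : V}
    (hu : ∀ v, B v u = 0) : u = 0 := by
  by_contra hu0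
  have hlt := h.neg_of_perp x u hx (hu x) hu0
  rw [hu] at hlt
  exact lt_irrefl _ hlt

end IsLorentzian

/-- The form `2 B(x, v) B(x, w) - B(x, x) B(v, w)`: up to scale it is `B` with the sign reversed on
the complement of `x`. When `B` is Lorentzian and `x` has positive square it is positive definite
and provides the norm in which lattice points are counted. -/
def majorant (B : LinearMap.BilinForm ℝ V) (x : V) : LinearMap.BilinForm ℝ V :=
  (2 : ℝ) • LinearMap.BilinForm.linMulLin (B x) (B x) - B x x • B

theorem majorant_apply (B : LinearMap.BilinForm ℝ V) (x v w : V) :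
    majorant B x v w = 2 * (B x v * B x w) - B x x * B v w := by
  simp [majorant]

namespace IsLorentzian

theorem majorant_symm (h : IsLorentzian B) (x : V) : LinearMap.IsSymm (majorant B x) :=
  ⟨fun v w => by simp only [majorant_apply, h.symm w v, mul_comm, RingHom.id_apply]⟩

theorem majorant_pos (h : IsLorentzian B) {x v : V} (hx : 0 < B x x) (hv : v ≠ 0) :
    0 < majorant B x v v := by
  rw [majorant_apply]
  rcases eq_or_ne (B x v) 0 with hxv | hxv
  · have := mul_pos hx (neg_pos.mpr (h.neg_of_perp x v hx hxv hv))
    rw [hxv]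
    linarith
  · have := mul_self_pos.mpr hxv
    have := h.apply_mul_apply_le_sq hx v
    nlinarith

theorem exists_abs_le [FiniteDimensional ℝ V] (h : IsLorentzian B) {x : V} (hx : 0 < B x x)
    (f : Module.Dual ℝ V) (R N : ℝ) :
    ∃ C, ∀ v, |B x v| ≤ R → -N ≤ B v v → |f v| ≤ C := by
  have hnonneg : ∀ v, 0 ≤ majorant B x v v := fun v => by
    rcases eq_or_ne v 0 with rfl | hv
    · simp
    · exact (h.majorant_pos hx hv).le
  have hinj : Function.Injective (majorant B x) :=
    (injective_iff_map_eq_zero _).mpr fun v hv => by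
      by_contra hv0
      exact (h.majorant_pos hx hv0).ne' (by rw [hv, LinearMap.zero_apply])
  obtain ⟨u, rfl⟩ := (LinearMap.injective_iff_surjective_of_finrank_eq_finrank
    (Subspace.dual_finrank_eq (K := ℝ) (V := V)).symm).mp hinj f
  refine ⟨√(majorant B x u u * (2 * R ^ 2 + B x x * N)), fun v hvR hvN => Real.abs_le_sqrt ?_⟩
  calc majorant B x u v ^ 2 ≤ majorant B x u u * majorant B x v v :=
        LinearMap.BilinForm.apply_sq_le_of_symm _ hnonneg (h.majorant_symm x) u v
    _ ≤ majorant B x u u * (2 * R ^ 2 + B x x * N) := by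
        refine mul_le_mul_of_nonneg_left ?_ (hnonneg u)
        have hR := sq_le_sq' (by linarith [abs_le.mp hvR]) (abs_le.mp hvR).2
        have hN := mul_le_mul_of_nonneg_left hvN hx.le
        rw [majorant_apply]
        linarith

end IsLorentzian

end LorentzianForms

section Cells

open SignType

variable {V : Type*} [AddCommGroup V] [Module ℝ V] {B : LinearMap.BilinForm ℝ V} {A : Set V}
  {p x y z : V}

/-- The lines spanned by the positive vectors `x` and `y` lie in the same cell of the arrangement of
the hyperplanes `a^⊥`, `a ∈ A`. The factor `sign (B x y)` makes the relation insensitive to the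
choice of a vector on each line. -/
def SameCell (B : LinearMap.BilinForm ℝ V) (A : Set V) (x y : V) : Prop :=
  ∀ a ∈ A, sign (B a y) = sign (B x y) * sign (B a x)

/-- The line spanned by the positive vector `p` lies in the closure of the cell of `x`, in terms of
signs as in `SameCell`: walls through `p` impose no condition. -/
def MemClosureCell (B : LinearMap.BilinForm ℝ V) (A : Set V) (p x : V) : Prop :=
  ∀ a ∈ A, B a p ≠ 0 → sign (B a x) = sign (B p x) * sign (B a p)

/-- The span of the normals of the walls through `x`. Its dimension is the codimension of the
smallest stratum containing `x`. -/
def wallSpan (B : LinearMap.BilinForm ℝ V) (A : Set V) (x : V) : Submodule ℝ V :=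
  Submodule.span ℝ {a ∈ A | B a x = 0}

/-- The cell of the positive vector `x` is a whole stratum. -/
def FillsStratum (B : LinearMap.BilinForm ℝ V) (A : Set V) (x : V) : Prop :=
  ∀ y, 0 < B y y → (∀ a ∈ A, B a x = 0 → B a y = 0) → SameCell B A x y

/-- Only finitely many of the hyperplanes `a^⊥`, `a ∈ A`, meet a given segment of positive
vectors. -/
def LocallyFiniteWalls (B : LinearMap.BilinForm ℝ V) (A : Set V) : Prop :=
  ∀ x y, 0 < B x x → 0 < B y y → 0 < B x y → {a ∈ A | B a x * B a y ≤ 0}.Finite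

/-- The isometries of `B` that permute the wall normals `A`. -/
def wallSymmetries (B : LinearMap.BilinForm ℝ V) (A : Set V) : Subgroup (V ≃ₗ[ℝ] V) where
  carrier := {g | (∀ v w, B (g v) (g w) = B v w) ∧ ∀ a, g a ∈ A ↔ a ∈ A}
  one_mem' := ⟨fun _ _ => rfl, fun _ => Iff.rfl⟩
  mul_mem' := fun hg hg' =>
    ⟨fun v w => (hg.1 _ _).trans (hg'.1 v w), fun a => (hg.2 _).trans (hg'.2 a)⟩
  inv_mem' := fun {g} hg =>
    ⟨fun v w => (hg.1 _ _).symm.trans (congrArg₂ (fun v w => B v w) (g.apply_symm_apply v)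
      (g.apply_symm_apply w)),
      fun a => (hg.2 _).symm.trans (iff_of_eq (congrArg (· ∈ A) (g.apply_symm_apply a)))⟩

theorem sign_mul_sign_self_of_ne_zero {r : ℝ} (hr : r ≠ 0) : sign r * sign r = 1 := by
  rw [← sign_mul, sign_pos (mul_self_pos.mpr hr)]

theorem SameCell.refl (hx : 0 < B x x) : SameCell B A x x := fun a _ => by
  rw [sign_pos hx, one_mul]

theorem SameCell.symm (h : IsLorentzian B) (hx : 0 < B x x) (hy : 0 < B y y)
    (hxy : SameCell B A x y) : SameCell B A y x := fun a ha => by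
  rw [hxy a ha, h.symm y x, ← mul_assoc, sign_mul_sign_self_of_ne_zero (h.apply_ne_zero hx hy),
    one_mul]

theorem SameCell.trans (h : IsLorentzian B) (hx : 0 < B x x) (hy : 0 < B y y) (hz : 0 < B z z)
    (hxy : SameCell B A x y) (hyz : SameCell B A y z) : SameCell B A x z := fun a ha => by
  rw [hyz a ha, hxy a ha, ← h.sign_apply_mul_sign_apply hx hy hz, ← mul_assoc,
    mul_comm (sign (B y z))]

theorem sameCell_smul_right {c : ℝ} (hc : c ≠ 0) :
    SameCell B A x (c • y) ↔ SameCell B A x y := by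
  simp only [SameCell, (B _).map_smul, smul_eq_mul, sign_mul, mul_assoc,
    mul_right_inj' (sign_ne_zero.mpr hc)]

theorem SameCell.memClosureCell_trans (h : IsLorentzian B) (hx : 0 < B x x) (hp : 0 < B p p)
    (hy : 0 < B y y) (hpx : SameCell B A p x) (hpy : MemClosureCell B A p y) :
    MemClosureCell B A x y := fun a ha hax => by
  have hap : B a p ≠ 0 := fun hap => hax (sign_eq_zero_iff.mp (by
    rw [hpx a ha, hap, sign_zero, mul_zero]))
  rw [hpy a ha hap, (hpx.symm h hp hx) a ha, ← h.sign_apply_mul_sign_apply hx hp hy, ← mul_assoc,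
    mul_comm (sign (B p y))]

theorem SameCell.wallSpan_eq (h : IsLorentzian B) (hx : 0 < B x x) (hy : 0 < B y y)
    (hxy : SameCell B A x y) : wallSpan B A x = wallSpan B A y := by
  have hzero : ∀ a ∈ A, B a x = 0 ↔ B a y = 0 := fun a ha => by
    rw [← sign_eq_zero_iff (a := B a y), hxy a ha, mul_eq_zero, sign_eq_zero_iff, sign_eq_zero_iff,
      or_iff_right (h.apply_ne_zero hx hy)]
  exact congrArg (Submodule.span ℝ) (Set.ext fun a => and_congr_right (hzero a))

theorem apply_eq_zero_of_mem_wallSpan (hxy : ∀ a ∈ A, B a x = 0 → B a y = 0) {v : V}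
    (hv : v ∈ wallSpan B A x) : B v y = 0 := by
  have hle : wallSpan B A x ≤ LinearMap.ker (B.flip y) :=
    Submodule.span_le.mpr fun a ha => hxy a ha.1 ha.2
  exact hle hv

theorem sameCell_map_iff {g : V ≃ₗ[ℝ] V} (hg : g ∈ wallSymmetries B A) :
    SameCell B A (g x) (g y) ↔ SameCell B A x y := by
  refine g.surjective.forall.trans (forall_congr' fun a => ?_)
  rw [hg.1, hg.1, hg.1, hg.2]

theorem MemClosureCell.map {g : V ≃ₗ[ℝ] V} (hg : g ∈ wallSymmetries B A)
    (hpx : MemClosureCell B A p x) : MemClosureCell B A (g p) (g x) := fun a ha hap => by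
  obtain ⟨a, rfl⟩ := g.surjective a
  rw [hg.1] at hap
  rw [hg.1, hg.1, hg.1, hpx a ((hg.2 a).mp ha) hap]

theorem wallSpan_map {g : V ≃ₗ[ℝ] V} (hg : g ∈ wallSymmetries B A) (x : V) :
    wallSpan B A (g x) = (wallSpan B A x).map (g : V →ₗ[ℝ] V) := by
  rw [wallSpan, wallSpan, Submodule.map_span]
  congr 1
  ext a
  obtain ⟨a, rfl⟩ := g.surjective a
  simp [hg.1, hg.2]

theorem exists_first_zero {ι : Type*} {u w : ι → ℝ} (hfin : {i | u i ≠ 0 ∧ u i * w i ≤ 0}.Finite)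
    (hne : ∃ i, u i ≠ 0 ∧ u i * w i ≤ 0) :
    ∃ t, 0 < t ∧ t ≤ 1 ∧ (∃ i, u i ≠ 0 ∧ (1 - t) * u i + t * w i = 0) ∧
      ∀ i, 0 ≤ u i * ((1 - t) * u i + t * w i) := by
  have hdiff : ∀ i, u i ≠ 0 ∧ u i * w i ≤ 0 → 0 < u i * (u i - w i) := fun i hi => by
    nlinarith [mul_self_pos.mpr hi.1]
  obtain ⟨i, hi, hmin⟩ :=
    Set.exists_min_image _ (fun i => u i * u i / (u i * (u i - w i))) hfin hne
  set t := u i * u i / (u i * (u i - w i))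
  have ht₀ : 0 < t := div_pos (mul_self_pos.mpr hi.1) (hdiff i hi)
  have ht₁ : t ≤ 1 := (div_le_one (hdiff i hi)).mpr (by nlinarith [hi.2])
  refine ⟨t, ht₀, ht₁, ⟨i, hi.1, ?_⟩, fun j => ?_⟩
  · have hmul : t * (u i * (u i - w i)) = u i * u i := div_mul_cancel₀ _ (hdiff i hi).ne'
    exact mul_left_cancel₀ hi.1 (by linarith)
  by_cases hj : u j ≠ 0 ∧ u j * w j ≤ 0
  · have := (le_div_iff₀ (hdiff j hj)).mp (hmin j hj)
    linarith
  · rw [not_and_or, not_not, not_le] at hj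
    rcases hj with hj | hj
    · rw [hj, zero_mul]
    · have h₁ := mul_nonneg (sub_nonneg.mpr ht₁) (mul_self_nonneg (u j))
      have h₂ := mul_pos ht₀ hj
      linarith

theorem sign_eq_of_mul_nonneg {r s : ℝ} (hrs : 0 ≤ r * s) (hr : r ≠ 0) (hs : s ≠ 0) :
    sign r = sign s := by
  rcases pos_and_pos_or_neg_and_neg_of_mul_pos (hrs.lt_of_ne (mul_ne_zero hr hs).symm)
    with ⟨h₁, h₂⟩ | ⟨h₁, h₂⟩
  · rw [sign_pos h₁, sign_pos h₂]
  · rw [sign_neg h₁, sign_neg h₂]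

theorem exists_memClosureCell_of_pos (h : IsLorentzian B) (hA : LocallyFiniteWalls B A)
    (hx : 0 < B x x) (hy : 0 < B y y) (hxy : 0 < B x y)
    (hwalls : ∀ a ∈ A, B a x = 0 → B a y = 0) (hne : ¬ SameCell B A x y) :
    ∃ p, 0 < B p p ∧ MemClosureCell B A p x ∧ wallSpan B A x < wallSpan B A p := by
  have hsep : ∃ a : A, B a x ≠ 0 ∧ B a x * B a y ≤ 0 := by
    by_contra! hall
    refine hne fun a ha => ?_
    rw [sign_pos hxy, one_mul]
    by_cases hax : B a x = 0
    · rw [hax, hwalls a ha hax]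
    · have hpos := hall ⟨a, ha⟩ hax
      exact (sign_eq_of_mul_nonneg hpos.le hax (right_ne_zero_of_mul hpos.ne')).symm
  have hfin : {a : A | B a x ≠ 0 ∧ B a x * B a y ≤ 0}.Finite :=
    Set.Finite.of_finite_image ((hA x y hx hy hxy).subset (by
      rintro _ ⟨a, ha, rfl⟩
      exact ⟨a.2, ha.2⟩)) Subtype.val_injective.injOn
  obtain ⟨t, ht₀, ht₁, ⟨⟨a, ha⟩, hax, hap⟩, hnonneg⟩ := exists_first_zero hfin hsep
  set p := (1 - t) • x + t • y with hp
  have hBp : ∀ v, B v p = (1 - t) * B v x + t * B v y := fun v => by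
    rw [hp, map_add, map_smul, map_smul, smul_eq_mul, smul_eq_mul]
  have hxp : 0 < B x p := by
    rw [hBp]
    nlinarith [mul_pos ht₀ hxy, mul_nonneg (sub_nonneg.mpr ht₁) hx.le]
  refine ⟨p, h.apply_self_pos_of_convex_combination hx hy hxy (sub_nonneg.mpr ht₁) ht₀.le
    (by ring), fun a ha hap => ?_, lt_of_le_not_ge ?_ fun hle => hax ?_⟩
  · have hax : B a x ≠ 0 := fun hax => hap (by rw [hBp, hax, hwalls a ha hax]; ring)
    rw [h.symm p x, sign_pos hxp, one_mul]
    exact sign_eq_of_mul_nonneg (by rw [hBp]; exact hnonneg ⟨a, ha⟩) hax hap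
  · exact Submodule.span_mono fun a ha =>
      ⟨ha.1, by rw [hBp, ha.2, hwalls a ha.1 ha.2]; ring⟩
  · exact apply_eq_zero_of_mem_wallSpan (fun _ _ => id)
      (hle (Submodule.subset_span ⟨ha, (hBp a).trans hap⟩))

theorem exists_memClosureCell_of_not_fillsStratum (h : IsLorentzian B)
    (hA : LocallyFiniteWalls B A) (hx : 0 < B x x) (hfill : ¬ FillsStratum B A x) :
    ∃ p, 0 < B p p ∧ MemClosureCell B A p x ∧ wallSpan B A x < wallSpan B A p := by
  simp only [FillsStratum, not_forall] at hfill
  obtain ⟨y, hy, hwalls, hne⟩ := hfill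
  rcases lt_or_gt_of_ne (h.apply_ne_zero hx hy) with hxy | hxy
  · exact exists_memClosureCell_of_pos h hA hx (y := (-1 : ℝ) • y) (by simpa using hy)
      (by simpa using hxy) (fun a ha hax => by rw [map_smul, hwalls a ha hax, smul_zero])
      (mt (sameCell_smul_right (by norm_num)).mp hne)
  · exact exists_memClosureCell_of_pos h hA hx hy hxy hwalls hne

/-- The cells of the positive vectors in `X` form finitely many orbits under the group `G` of
isometries; the representatives need not belong to `X`. -/
def FinitelyManyCellOrbits (B : LinearMap.BilinForm ℝ V) (A : Set V) (G : Subgroup (V ≃ₗ[ℝ] V))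
    (X : Set V) : Prop :=
  ∃ T : Set V, T.Finite ∧ (∀ t ∈ T, 0 < B t t) ∧
    ∀ x ∈ X, 0 < B x x → ∃ t ∈ T, ∃ g ∈ G, SameCell B A (g t) x

namespace FinitelyManyCellOrbits

variable {G : Subgroup (V ≃ₗ[ℝ] V)} {X Y : Set V}

theorem biUnion {ι : Type*} {I : Set ι} (hI : I.Finite) {X : ι → Set V}
    (hX : ∀ i ∈ I, FinitelyManyCellOrbits B A G (X i)) :
    FinitelyManyCellOrbits B A G (⋃ i ∈ I, X i) := by
  choose! T hT hTpos hrep using hX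
  refine ⟨⋃ i ∈ I, T i, hI.biUnion hT, fun t ht => ?_, fun x hx hxpos => ?_⟩
  · obtain ⟨i, hi, ht⟩ := Set.mem_iUnion₂.mp ht
    exact hTpos i hi t ht
  · obtain ⟨i, hi, hx⟩ := Set.mem_iUnion₂.mp hx
    obtain ⟨t, ht, hg⟩ := hrep i hi x hx hxpos
    exact ⟨t, Set.mem_biUnion hi ht, hg⟩

theorem union (hX : FinitelyManyCellOrbits B A G X) (hY : FinitelyManyCellOrbits B A G Y) :
    FinitelyManyCellOrbits B A G (X ∪ Y) := by
  obtain ⟨S, hS, hSpos, hSrep⟩ := hX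
  obtain ⟨T, hT, hTpos, hTrep⟩ := hY
  refine ⟨S ∪ T, hS.union hT, fun t ht => ht.elim (hSpos t) (hTpos t), ?_⟩
  rintro x (hx | hx) hxpos
  · exact (hSrep x hx hxpos).imp fun t ht => ⟨Or.inl ht.1, ht.2⟩
  · exact (hTrep x hx hxpos).imp fun t ht => ⟨Or.inr ht.1, ht.2⟩

theorem mono (hXY : X ⊆ Y) (hY : FinitelyManyCellOrbits B A G Y) :
    FinitelyManyCellOrbits B A G X :=
  hY.imp fun _ hT => ⟨hT.1, hT.2.1, fun x hx => hT.2.2 x (hXY hx)⟩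

theorem of_translates (hG : G ≤ wallSymmetries B A)
    (hX : FinitelyManyCellOrbits B A G X)
    (hY : ∀ y ∈ Y, 0 < B y y → ∃ g ∈ G, g y ∈ X) : FinitelyManyCellOrbits B A G Y := by
  obtain ⟨T, hT, hTpos, hrep⟩ := hX
  refine ⟨T, hT, hTpos, fun y hy hypos => ?_⟩
  obtain ⟨g, hg, hgy⟩ := hY y hy hypos
  obtain ⟨t, ht, g', hg', hcell⟩ := hrep _ hgy (by rwa [(hG hg).1])
  refine ⟨t, ht, g⁻¹ * g', G.mul_mem (G.inv_mem hg) hg', ?_⟩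
  have := (sameCell_map_iff (hG (G.inv_mem hg))).mpr hcell
  rwa [← LinearEquiv.mul_apply, ← LinearEquiv.mul_apply, inv_mul_cancel] at this

end FinitelyManyCellOrbits

/-- Near `p` the arrangement only consists of the finitely many walls through `p`. -/
theorem finitelyManyCellOrbits_memClosureCell (h : IsLorentzian B) (hA : LocallyFiniteWalls B A)
    (G : Subgroup (V ≃ₗ[ℝ] V)) (hp : 0 < B p p) :
    FinitelyManyCellOrbits B A G {x | MemClosureCell B A p x} := by
  have hfin : Finite {a ∈ A | B a p = 0} :=
    (hA p p hp hp hp).subset fun a ha => ⟨ha.1, by rw [ha.2, zero_mul]⟩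
  let side : V → {a ∈ A | B a p = 0} → SignType := fun x a => sign (B p x) * sign (B a x)
  obtain ⟨T, hTX, hT⟩ := Set.exists_subset_bijOn {x | MemClosureCell B A p x ∧ 0 < B x x} side
  refine ⟨T, hT.finite_iff_finite.mpr (Set.toFinite _), fun t ht => (hTX ht).2,
    fun x hx hxpos => ?_⟩
  obtain ⟨t, ht, hside⟩ := hT.surjOn ⟨x, ⟨hx, hxpos⟩, rfl⟩
  obtain ⟨htp, htpos⟩ := hTX ht
  have hall : ∀ a ∈ A, sign (B p x) * sign (B a x) = sign (B p t) * sign (B a t) := by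
    intro a ha
    by_cases hap : B a p = 0
    · exact (congrFun hside ⟨a, ha, hap⟩).symm
    · rw [hx a ha hap, htp a ha hap, ← mul_assoc, ← mul_assoc,
        sign_mul_sign_self_of_ne_zero (h.apply_ne_zero hp hxpos),
        sign_mul_sign_self_of_ne_zero (h.apply_ne_zero hp htpos)]
  refine ⟨t, ht, 1, G.one_mem, fun a ha => ?_⟩
  change sign (B a x) = sign (B t x) * sign (B a t)
  rw [← h.sign_apply_mul_sign_apply htpos hp hxpos, h.symm t p, mul_comm (sign (B p t)), mul_assoc,
    ← hall a ha, ← mul_assoc, sign_mul_sign_self_of_ne_zero (h.apply_ne_zero hp hxpos), one_mul]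

theorem FinitelyManyCellOrbits.of_memClosureCell (h : IsLorentzian B)
    (hA : LocallyFiniteWalls B A) {G : Subgroup (V ≃ₗ[ℝ] V)} (hG : G ≤ wallSymmetries B A)
    {X : Set V} (hX : FinitelyManyCellOrbits B A G X) :
    FinitelyManyCellOrbits B A G {x | ∃ p ∈ X, 0 < B p p ∧ MemClosureCell B A p x} := by
  obtain ⟨T, hT, hTpos, hrep⟩ := hX
  refine (biUnion hT fun t ht => finitelyManyCellOrbits_memClosureCell h hA G
    (hTpos t ht)).of_translates hG ?_
  rintro x ⟨p, hpX, hp, hpx⟩ hx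
  obtain ⟨t, ht, g, hg, hcell⟩ := hrep p hpX hp
  refine ⟨g⁻¹, G.inv_mem hg, Set.mem_biUnion ht ?_⟩
  have hgt : 0 < B (g t) (g t) := by rw [(hG hg).1]; exact hTpos t ht
  have := ((hcell.symm h hgt hp).memClosureCell_trans h hgt hp hx hpx).map (hG (G.inv_mem hg))
  rwa [← LinearEquiv.mul_apply, inv_mul_cancel] at this

open Module in
theorem finitelyManyCellOrbits_of_fillsStratum [FiniteDimensional ℝ V] (h : IsLorentzian B)
    (hA : LocallyFiniteWalls B A) {G : Subgroup (V ≃ₗ[ℝ] V)} (hG : G ≤ wallSymmetries B A)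
    (hfill : FinitelyManyCellOrbits B A G {x | FillsStratum B A x}) :
    FinitelyManyCellOrbits B A G Set.univ := by
  suffices ∀ j, FinitelyManyCellOrbits B A G {x | finrank ℝ V < finrank ℝ (wallSpan B A x) + j} from
    (this (finrank ℝ V + 1)).mono fun x _ => by
      simp only [Set.mem_ofPred_eq]
      omega
  intro j
  induction j with
  | zero =>
    refine ⟨∅, Set.finite_empty, by simp, fun x hx => ?_⟩
    exact absurd (Submodule.finrank_le (wallSpan B A x)) (not_le.mpr hx)
  | succ j ih =>
    refine (hfill.union (ih.of_memClosureCell h hA hG)).of_translates hG fun x hx hxpos =>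
      ⟨1, G.one_mem, or_iff_not_imp_left.mpr fun hnot => ?_⟩
    obtain ⟨p, hp, hpx, hlt⟩ := exists_memClosureCell_of_not_fillsStratum h hA hxpos hnot
    have := Submodule.finrank_lt_finrank_of_lt hlt
    refine ⟨p, ?_, hp, hpx⟩
    simp only [Set.mem_ofPred_eq] at hx ⊢
    omega

end Cells

section Lattices

open Module

variable {L : Type*} [AddCommGroup L] {q : QuadraticForm ℤ L} {S : Set L}

theorem realBilin_tmul (q : QuadraticForm ℤ L) (a c : ℝ) (s t : L) :
    realBilin q (a ⊗ₜ[ℤ] s) (c ⊗ₜ[ℤ] t) = a * c * (q.polarBilin s t : ℝ) := by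
  simp [realBilin, LinearMap.BilinForm.baseChange_tmul, mul_comm]

theorem realBilin_symm (q : QuadraticForm ℤ L) (x y : RealSpace L) :
    realBilin q x y = realBilin q y x := by
  rw [← polar_realForm, ← polar_realForm, QuadraticMap.polar_comm]

theorem realBilin_self (q : QuadraticForm ℤ L) (x : RealSpace L) :
    realBilin q x x = 2 * realForm q x := by
  simp [realForm]

theorem HasSignature.finrank_le_of_nonneg [Module.Free ℤ L] [Module.Finite ℤ L] {a b : ℕ}
    (hq : HasSignature q a b) {W : Submodule ℝ (RealSpace L)} (hW : ∀ v ∈ W, 0 ≤ realForm q v) :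
    finrank ℝ W ≤ a := by
  have hle := QuadraticForm.sigPos_add_finrank_le_of_nonpos (Q := -realForm q) (V := W)
    fun v hv => neg_nonpos.mpr (hW v hv)
  rw [sigPos_neg, hq.2.2, finrank_baseChange, hq.1] at hle
  omega

theorem HasSignature.isLorentzian [Module.Free ℤ L] [Module.Finite ℤ L] {n : ℕ}
    (hq : HasSignature q 1 n) : IsLorentzian (realBilin q) := by
  refine ⟨realBilin_symm q, fun x y hx hxy hy => ?_⟩
  by_contra! hyy
  have hli : LinearIndependent ℝ ![x, y] := by
    refine LinearIndependent.pair_iff.mpr fun a c hac => ?_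
    obtain rfl : a = 0 := by simpa [hxy, hx.ne'] using congrArg (realBilin q x) hac
    exact ⟨rfl, by simpa [hy] using hac⟩
  have hrank := finrank_span_eq_card hli
  rw [Matrix.range_cons_cons_empty, Fintype.card_fin] at hrank
  have hle := hq.finrank_le_of_nonneg (W := Submodule.span ℝ {x, y}) fun v hv => by
    obtain ⟨a, c, rfl⟩ := Submodule.mem_span_pair.mp hv
    have hself := realBilin_self q (a • x + c • y)
    simp only [map_add, map_smul, LinearMap.add_apply, LinearMap.smul_apply, smul_eq_mul,
      realBilin_symm q y x, hxy] at hself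
    nlinarith [mul_nonneg (mul_self_nonneg a) hx.le, mul_nonneg (mul_self_nonneg c) hyy]
  omega

/-- The vectors of `S`, viewed in `V = L ⊗ ℝ` as normals of the walls of the tessellation. -/
def wallNormals (S : Set L) : Set (RealSpace L) :=
  TensorProduct.mk ℤ ℝ L 1 '' S

/-- The action of the isometries of `L` on `V = L ⊗ ℝ`. -/
def realAction (q : QuadraticForm ℤ L) : orthogonalGroup q →* (RealSpace L ≃ₗ[ℝ] RealSpace L) where
  toFun γ := LinearEquiv.baseChange ℤ ℝ L L γ
  map_one' := LinearEquiv.baseChange_one ℤ ℝ L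
  map_mul' γ δ := LinearEquiv.baseChange_mul ℤ ℝ L γ δ

theorem realAction_tmul (γ : orthogonalGroup q) (a : ℝ) (s : L) :
    realAction q γ (a ⊗ₜ[ℤ] s) = a ⊗ₜ[ℤ] (γ : L ≃ₗ[ℤ] L) s :=
  rfl

theorem realBilin_realAction (γ : orthogonalGroup q) (x y : RealSpace L) :
    realBilin q (realAction q γ x) (realAction q γ y) = realBilin q x y := by
  have hγ : ∀ s t, q.polarBilin ((γ : L ≃ₗ[ℤ] L) s) ((γ : L ≃ₗ[ℤ] L) t) = q.polarBilin s t :=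
    fun s t => by
      simp only [QuadraticMap.polarBilin_apply_apply, QuadraticMap.polar, ← map_add]
      rw [γ.2, γ.2, γ.2]
  induction x using TensorProduct.induction_on with
  | zero => simp
  | add u v hu hv => simp only [map_add, LinearMap.add_apply, hu, hv]
  | tmul a s =>
    induction y using TensorProduct.induction_on with
    | zero => simp
    | add u v hu hv => simp only [map_add, hu, hv]
    | tmul c t => rw [realAction_tmul, realAction_tmul, realBilin_tmul, realBilin_tmul, hγ]

theorem map_realAction_le_wallSymmetries {Γ : Subgroup (orthogonalGroup q)}
    (hS : ∀ γ ∈ Γ, ∀ s ∈ S, (γ : L ≃ₗ[ℤ] L) s ∈ S) :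
    Γ.map (realAction q) ≤ wallSymmetries (realBilin q) (wallNormals S) := by
  have himage : ∀ γ ∈ Γ, ∀ a ∈ wallNormals S, realAction q γ a ∈ wallNormals S := by
    rintro γ hγ _ ⟨s, hs, rfl⟩
    exact ⟨_, hS γ hγ s hs, rfl⟩
  rintro _ ⟨γ, hγ, rfl⟩
  refine ⟨realBilin_realAction γ, fun a => ⟨fun ha => ?_, himage γ hγ a⟩⟩
  have := himage γ⁻¹ (Γ.inv_mem hγ) _ ha
  rwa [← LinearEquiv.mul_apply, ← map_mul, inv_mul_cancel, map_one] at this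

theorem finite_setOf_abs_le [Module.Free ℤ L] [Module.Finite ℤ L]
    (h : IsLorentzian (realBilin q)) {x : RealSpace L} (hx : 0 < realBilin q x x) (R : ℝ) (N : ℤ) :
    {s : L | |realBilin q x ((1 : ℝ) ⊗ₜ[ℤ] s)| ≤ R ∧ -N ≤ q.polarBilin s s}.Finite := by
  let e := Free.chooseBasis ℤ L
  choose C hC using fun i => h.exists_abs_le hx ((e.baseChange ℝ).coord i) R N
  refine Set.Finite.of_finite_image (f := e.equivFun) ?_ e.equivFun.injective.injOn
  refine (Set.Finite.pi' fun i => Set.finite_Icc (-⌊C i⌋) ⌊C i⌋).subset ?_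
  rintro _ ⟨s, ⟨hs, hsN⟩, rfl⟩ i
  have hcoord := hC i ((1 : ℝ) ⊗ₜ[ℤ] s) hs (by
    rw [realBilin_tmul, one_mul, one_mul]
    exact_mod_cast hsN)
  rw [Set.mem_Icc, ← abs_le, Int.le_floor]
  simpa using hcoord

theorem locallyFiniteWalls_wallNormals [Module.Free ℤ L] [Module.Finite ℤ L]
    (h : IsLorentzian (realBilin q)) {N : ℤ} (hN : ∀ s ∈ S, -N ≤ q.polarBilin s s) :
    LocallyFiniteWalls (realBilin q) (wallNormals S) := by
  intro x y hx hy hxy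
  set B := realBilin q
  let K := B x y ^ 2 - B x x * B y y
  have hK : 0 ≤ K := sub_nonneg.mpr (h.apply_mul_apply_le_sq hx y)
  refine ((finite_setOf_abs_le h hx √(N * K / B y y) N).image (TensorProduct.mk ℤ ℝ L 1)).subset ?_
  rintro _ ⟨⟨s, hs, rfl⟩, hsep⟩
  refine ⟨s, ⟨Real.abs_le_sqrt ?_, hN s hs⟩, rfl⟩
  have hself : -(N : ℝ) ≤ B ((1 : ℝ) ⊗ₜ[ℤ] s) ((1 : ℝ) ⊗ₜ[ℤ] s) := by
    rw [realBilin_tmul, one_mul, one_mul]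
    exact_mod_cast hN s hs
  rw [h.symm _ x, h.symm _ y] at hsep
  rw [le_div_iff₀' hy]
  exact (h.mul_sq_apply_le_of_separates hx hxy hsep).trans
    (mul_le_mul_of_nonneg_right (neg_le.mp hself) hK)

theorem det_gram_basis_ne_zero (h : IsLorentzian (realBilin q)) {x : RealSpace L}
    (hx : 0 < realBilin q x x) {ι : Type*} [Fintype ι] [DecidableEq ι] (e : Basis ι ℤ L) :
    (gram q.polarBilin e).det ≠ 0 := by
  have := Free.of_basis e
  intro hdet
  obtain ⟨c, hc₀, hc⟩ := Matrix.exists_vecMul_eq_zero_iff.mpr hdet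
  rw [← pairing_sum_smul] at hc
  set u := ∑ i, c i • e i
  have hpolar : q.polarBilin u = 0 := e.ext (congrFun hc)
  have hreal : ∀ v, realBilin q v ((1 : ℝ) ⊗ₜ[ℤ] u) = 0 := fun v => by
    induction v using TensorProduct.induction_on with
    | zero => simp
    | tmul a s =>
      rw [realBilin_symm, realBilin_tmul, hpolar, LinearMap.zero_apply, Int.cast_zero, mul_zero]
    | add v w hv hw => rw [map_add, LinearMap.add_apply, hv, hw, add_zero]
  have hu₀ : u = 0 := (map_eq_zero_iff _ (Flat.tensorProduct_mk_injective ℤ L ℝ)).mp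
    (h.eq_zero_of_forall_apply_eq_zero hx hreal)
  exact hc₀ (funext (Fintype.linearIndependent_iff.mp e.linearIndependent c hu₀))

theorem det_gram_ne_zero_of_perp (h : IsLorentzian (realBilin q)) {x : RealSpace L}
    (hx : 0 < realBilin q x x) {ι : Type*} [Fintype ι] [DecidableEq ι] {s : ι → L}
    (hs : ∀ i, realBilin q ((1 : ℝ) ⊗ₜ[ℤ] s i) x = 0)
    (hli : LinearIndependent ℝ fun i => ((1 : ℝ) ⊗ₜ[ℤ] s i : RealSpace L)) :
    (gram q.polarBilin s).det ≠ 0 := by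
  intro hdet
  obtain ⟨c, hc₀, hc⟩ := Matrix.exists_mulVec_eq_zero_iff.mpr hdet
  set u := TensorProduct.mk ℤ ℝ L 1 (∑ i, c i • s i) with hu
  have hsum : u = ∑ i, (c i : ℝ) • ((1 : ℝ) ⊗ₜ[ℤ] s i : RealSpace L) := by
    simp only [hu, map_sum, TensorProduct.mk_apply, TensorProduct.tmul_smul, Int.cast_smul_eq_zsmul]
  have hperp : realBilin q x u = 0 := by
    rw [h.symm, hsum]
    simp only [map_sum, map_smul, LinearMap.sum_apply, LinearMap.smul_apply, hs, smul_zero,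
      Finset.sum_const_zero]
  have hself : realBilin q u u = 0 := by
    rw [hu, TensorProduct.mk_apply, realBilin_tmul, bilin_sum_smul, hc, dotProduct_zero,
      Int.cast_zero, mul_zero]
  have hu₀ : u = 0 := by
    by_contra hne
    exact (h.neg_of_perp _ _ hx hperp hne).ne hself
  refine hc₀ (funext fun i => ?_)
  exact_mod_cast Fintype.linearIndependent_iff.mp hli _ (hsum ▸ hu₀) i

theorem abs_polarBilin_le_of_perp (h : IsLorentzian (realBilin q)) {x : RealSpace L}
    (hx : 0 < realBilin q x x) {N : ℤ} {s t : L} (hs : realBilin q ((1 : ℝ) ⊗ₜ[ℤ] s) x = 0)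
    (ht : realBilin q ((1 : ℝ) ⊗ₜ[ℤ] t) x = 0) (hsN : -N ≤ q.polarBilin s s)
    (htN : -N ≤ q.polarBilin t t) : |q.polarBilin s t| ≤ N := by
  rw [h.symm] at hs ht
  have hst := h.sq_apply_le_of_perp hx hs ht
  have hss := h.nonpos_of_perp hx hs
  have htt := h.nonpos_of_perp hx ht
  simp only [realBilin_tmul, one_mul] at hst hss htt
  norm_cast at hst hss htt
  refine abs_le_of_sq_le_sq (hst.trans ?_) (by linarith)
  nlinarith

theorem exists_linearIndependent_tuple_perp [Module.Finite ℤ L] {x : RealSpace L} {k : ℕ}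
    (hk : k ≤ finrank ℝ (wallSpan (realBilin q) (wallNormals S) x)) :
    ∃ s : Fin k → L, (∀ i, s i ∈ S ∧ realBilin q ((1 : ℝ) ⊗ₜ[ℤ] s i) x = 0) ∧
      LinearIndependent ℝ fun i => ((1 : ℝ) ⊗ₜ[ℤ] s i : RealSpace L) := by
  obtain ⟨f, hf, -, hli⟩ := Submodule.exists_fun_fin_finrank_span_eq ℝ
    {a ∈ wallNormals S | realBilin q a x = 0}
  choose s hsS hsf using fun i => (hf i).1
  obtain rfl : (fun i => (1 : ℝ) ⊗ₜ[ℤ] s i) = f := funext hsf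
  exact ⟨s ∘ Fin.castLE hk, fun i => ⟨hsS _, (hf _).2⟩, hli.comp _ (Fin.castLE_injective hk)⟩

theorem span_le_wallSpan {ι : Type*} {s : ι → L} {x : RealSpace L}
    (hs : ∀ i, s i ∈ S ∧ realBilin q ((1 : ℝ) ⊗ₜ[ℤ] s i) x = 0) :
    Submodule.span ℝ (Set.range fun i => ((1 : ℝ) ⊗ₜ[ℤ] s i : RealSpace L)) ≤
      wallSpan (realBilin q) (wallNormals S) x :=
  Submodule.span_mono (Set.range_subset_iff.mpr fun i => ⟨⟨s i, (hs i).1, rfl⟩, (hs i).2⟩)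

theorem span_eq_wallSpan_iff [Module.Finite ℤ L] {ι : Type*} [Fintype ι] {s : ι → L}
    {x : RealSpace L} (hs : ∀ i, s i ∈ S ∧ realBilin q ((1 : ℝ) ⊗ₜ[ℤ] s i) x = 0)
    (hli : LinearIndependent ℝ fun i => ((1 : ℝ) ⊗ₜ[ℤ] s i : RealSpace L)) :
    Submodule.span ℝ (Set.range fun i => ((1 : ℝ) ⊗ₜ[ℤ] s i : RealSpace L)) =
        wallSpan (realBilin q) (wallNormals S) x ↔
      finrank ℝ (wallSpan (realBilin q) (wallNormals S) x) ≤ Fintype.card ι := by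
  rw [← finrank_span_eq_card hli]
  exact ⟨fun heq => heq ▸ le_rfl, Submodule.eq_of_le_of_finrank_le (span_le_wallSpan hs)⟩

theorem exists_finite_tuples_span_eq_wallSpan [Module.Free ℤ L] [Module.Finite ℤ L]
    (h : IsLorentzian (realBilin q)) (Γ : Subgroup (orthogonalGroup q)) [Γ.FiniteIndex] {N : ℤ}
    (hN : ∀ s ∈ S, -N ≤ q.polarBilin s s) (k : ℕ) :
    ∃ R : Set (Fin k → L), R.Finite ∧ ∀ x, 0 < realBilin q x x →
      finrank ℝ (wallSpan (realBilin q) (wallNormals S) x) = k → ∃ r ∈ R, ∃ γ ∈ Γ,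
        Submodule.span ℝ (Set.range fun i => realAction q γ ((1 : ℝ) ⊗ₜ[ℤ] r i)) =
          wallSpan (realBilin q) (wallNormals S) x := by
  by_cases hex : ∃ x, 0 < realBilin q x x ∧
    finrank ℝ (wallSpan (realBilin q) (wallNormals S) x) = k
  swap
  · exact ⟨∅, Set.finite_empty, fun x hx hxk => absurd ⟨x, hx, hxk⟩ hex⟩
  obtain ⟨x₀, hx₀, hk₀⟩ := hex
  have hk := Submodule.finrank_le (wallSpan (realBilin q) (wallNormals S) x₀)
  rw [finrank_baseChange, hk₀] at hk
  let e := finBasis ℤ L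
  obtain ⟨R, hR, hrep⟩ := exists_finite_tuples_of_finiteIndex (det_gram_basis_ne_zero h hx₀ e)
    (annihilatesDiscriminant_det_gram e) Γ hk N
  refine ⟨R, hR, fun x hx hxk => ?_⟩
  obtain ⟨s, hs, hli⟩ := exists_linearIndependent_tuple_perp hxk.ge
  obtain ⟨r, hr, γ, hγ, rfl⟩ := hrep s
    (det_gram_ne_zero_of_perp h hx (fun i => (hs i).2) hli) fun i j =>
      abs_polarBilin_le_of_perp h hx (hs i).2 (hs j).2 (hN _ (hs i).1) (hN _ (hs j).1)
  exact ⟨r, hr, γ, hγ, (span_eq_wallSpan_iff hs hli).mpr (by rw [hxk, Fintype.card_fin])⟩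

theorem finitelyManyCellOrbits_fillsStratum_of_finrank [Module.Free ℤ L] [Module.Finite ℤ L]
    (h : IsLorentzian (realBilin q)) (Γ : Subgroup (orthogonalGroup q)) [Γ.FiniteIndex] {N : ℤ}
    (hN : ∀ s ∈ S, -N ≤ q.polarBilin s s) (k : ℕ) :
    FinitelyManyCellOrbits (realBilin q) (wallNormals S) (Γ.map (realAction q))
      {x | FillsStratum (realBilin q) (wallNormals S) x ∧
        finrank ℝ (wallSpan (realBilin q) (wallNormals S) x) = k} := by
  obtain ⟨R, hR, hrep⟩ := exists_finite_tuples_span_eq_wallSpan h Γ hN k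
  let Y : (Fin k → L) → Set (RealSpace L) := fun r =>
    {y | 0 < realBilin q y y ∧ ∀ i, realBilin q ((1 : ℝ) ⊗ₜ[ℤ] r i) y = 0}
  choose! y hy using fun r (hr : (Y r).Nonempty) => hr
  refine ⟨y '' {r ∈ R | (Y r).Nonempty}, (hR.sep _).image _, ?_, ?_⟩
  · rintro _ ⟨r, ⟨-, hr⟩, rfl⟩
    exact (hy r hr).1
  rintro x ⟨hfill, hxk⟩ hx
  obtain ⟨r, hr, γ, hγ, hspan⟩ := hrep x hx hxk
  have hperp : ∀ z, (∀ i, realBilin q (realAction q γ ((1 : ℝ) ⊗ₜ[ℤ] r i)) z = 0) ↔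
      ∀ v ∈ wallSpan (realBilin q) (wallNormals S) x, realBilin q v z = 0 := fun z => by
    change _ ↔ _ ≤ LinearMap.ker ((realBilin q).flip z)
    rw [← hspan, Submodule.span_le, Set.range_subset_iff]
    rfl
  have hYr : (Y r).Nonempty := by
    obtain ⟨z, rfl⟩ := (realAction q γ).surjective x
    have hzero := (hperp _).mpr fun v => apply_eq_zero_of_mem_wallSpan fun _ _ => id
    simp only [realBilin_realAction] at hx hzero
    exact ⟨z, hx, hzero⟩
  have hpos : 0 < realBilin q (realAction q γ (y r)) (realAction q γ (y r)) := by
    rw [realBilin_realAction]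
    exact (hy r hYr).1
  refine ⟨y r, ⟨r, ⟨hr, hYr⟩, rfl⟩, realAction q γ, ⟨γ, hγ, rfl⟩,
    (hfill _ hpos fun a ha hax => ?_).symm h hx hpos⟩
  refine (hperp _).mp (fun i => ?_) a (Submodule.subset_span ⟨ha, hax⟩)
  rw [realBilin_realAction]
  exact (hy r hYr).2 i

theorem finitelyManyCellOrbits_wallNormals [Module.Free ℤ L] [Module.Finite ℤ L]
    (h : IsLorentzian (realBilin q)) {Γ : Subgroup (orthogonalGroup q)} [Γ.FiniteIndex]
    (hS : ∀ γ ∈ Γ, ∀ s ∈ S, (γ : L ≃ₗ[ℤ] L) s ∈ S) {N : ℤ}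
    (hN : ∀ s ∈ S, -N ≤ q.polarBilin s s) :
    FinitelyManyCellOrbits (realBilin q) (wallNormals S) (Γ.map (realAction q)) Set.univ := by
  refine finitelyManyCellOrbits_of_fillsStratum h (locallyFiniteWalls_wallNormals h hN)
    (map_realAction_le_wallSymmetries hS) ?_
  refine (FinitelyManyCellOrbits.biUnion (Set.finite_Iic (finrank ℤ L)) fun k _ =>
    finitelyManyCellOrbits_fillsStratum_of_finrank h Γ hN k).mono fun x hx => ?_
  have hrank := Submodule.finrank_le (wallSpan (realBilin q) (wallNormals S) x)
  rw [finrank_baseChange] at hrank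
  exact Set.mem_biUnion (Set.mem_Iic.mpr hrank) ⟨hx, rfl⟩

end Lattices

section Convexity

open SignType

variable {V : Type*} [AddCommGroup V] [Module ℝ V] {B : LinearMap.BilinForm ℝ V}

theorem convex_setOf_sign_eq (f : V →ₗ[ℝ] ℝ) (ε : SignType) : Convex ℝ {v | sign (f v) = ε} := by
  cases ε
  · simpa only [zero_eq_zero, sign_eq_zero_iff] using convex_hyperplane f.isLinear 0
  · simpa only [neg_eq_neg_one, sign_eq_neg_one_iff] using convex_halfSpace_lt f.isLinear 0
  · simpa only [pos_eq_one, sign_eq_one_iff] using convex_halfSpace_gt f.isLinear 0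

theorem IsLorentzian.convex_setOf_pos (h : IsLorentzian B) {x : V} (hx : 0 < B x x) :
    Convex ℝ {v | 0 < B v v ∧ 0 < B x v} := by
  rintro v ⟨hv, hxv⟩ w ⟨hw, hxw⟩ a c ha hc hac
  have hvw : 0 < B v w := by
    rw [← sign_eq_one_iff, ← h.sign_apply_mul_sign_apply hv hx hw, h.symm v x, sign_pos hxv,
      sign_pos hxw, one_mul]
  exact ⟨h.apply_self_pos_of_convex_combination hv hw hvw ha hc hac,
    convex_halfSpace_gt (B x).isLinear 0 hxv hxw ha hc hac⟩

theorem IsLorentzian.convex_setOf_sameCell (h : IsLorentzian B) (A : Set V) {x : V}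
    (hx : 0 < B x x) : Convex ℝ {v | (0 < B v v ∧ 0 < B x v) ∧ SameCell B A x v} := by
  have heq : {v | (0 < B v v ∧ 0 < B x v) ∧ SameCell B A x v} =
      {v | 0 < B v v ∧ 0 < B x v} ∩ ⋂ a ∈ A, {v | sign (B a v) = sign (B a x)} := by
    ext v
    simp only [Set.mem_inter_iff, Set.mem_iInter, Set.mem_ofPred_eq]
    refine and_congr_right fun hv => forall₂_congr fun a _ => ?_
    rw [sign_pos hv.2, one_mul]
  rw [heq]
  exact (h.convex_setOf_pos hx).inter (convex_iInter₂ fun a _ => convex_setOf_sign_eq _ _)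

end Convexity

section Faces

open Module

variable {L : Type*} [AddCommGroup L] {q : QuadraticForm ℤ L} {S : Set L} {x y : RealSpace L}

/-- The set of points of `ℍ` on the same side of each hyperplane `s^⊥`, `s ∈ S`, as the point
represented by the positive vector `x`. These are the faces of the tessellation, described without
topology. -/
def cell (q : QuadraticForm ℤ L) (S : Set L) (x : RealSpace L) : Set (ℙ ℝ (RealSpace L)) :=
  {p | 0 < realBilin q p.rep p.rep ∧ SameCell (realBilin q) (wallNormals S) x p.rep}

theorem apply_rep_mk_mul_pos_iff (f g : RealSpace L →ₗ[ℝ] ℝ) {v : RealSpace L} (hv : v ≠ 0) :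
    0 < f (Projectivization.mk ℝ v hv).rep * g (Projectivization.mk ℝ v hv).rep ↔
      0 < f v * g v := by
  obtain ⟨c, hc⟩ := Projectivization.exists_smul_eq_mk_rep ℝ v hv
  rw [← hc, Units.smul_def, map_smul, map_smul, smul_eq_mul, smul_eq_mul, mul_mul_mul_comm,
    mul_pos_iff_of_pos_left (mul_self_pos.mpr c.ne_zero)]

theorem mk_mem_cell {v : RealSpace L} (hv : v ≠ 0) :
    Projectivization.mk ℝ v hv ∈ cell q S x ↔
      0 < realBilin q v v ∧ SameCell (realBilin q) (wallNormals S) x v := by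
  obtain ⟨c, hc⟩ := Projectivization.exists_smul_eq_mk_rep ℝ v hv
  rw [cell, Set.mem_ofPred_eq, ← hc, Units.smul_def, sameCell_smul_right c.ne_zero]
  simp only [map_smul, LinearMap.smul_apply, smul_eq_mul, ← mul_assoc]
  rw [mul_pos_iff_of_pos_left (mul_self_pos.mpr c.ne_zero)]

theorem cell_eq_of_sameCell (h : IsLorentzian (realBilin q)) (hx : 0 < realBilin q x x)
    (hy : 0 < realBilin q y y) (hxy : SameCell (realBilin q) (wallNormals S) x y) :
    cell q S x = cell q S y :=
  Set.ext fun _ => and_congr_right fun hp =>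
    ⟨(hxy.symm h hx hy).trans h hy hx hp, hxy.trans h hx hy hp⟩

theorem ne_zero_of_apply_self_pos (hx : 0 < realBilin q x x) : x ≠ 0 := by
  rintro rfl
  simp at hx

theorem image_cell {γ : orthogonalGroup q}
    (hγ : realAction q γ ∈ wallSymmetries (realBilin q) (wallNormals S)) (x : RealSpace L) :
    projAct (γ : L ≃ₗ[ℤ] L) '' cell q S x = cell q S (realAction q γ x) := by
  have hmk : ∀ v (hv : v ≠ 0), projAct (γ : L ≃ₗ[ℤ] L) (Projectivization.mk ℝ v hv) =
    Projectivization.mk ℝ (realAction q γ v) ((realAction q γ).map_ne_zero_iff.mpr hv) :=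
    fun _ _ => rfl
  have hmem : ∀ p, projAct (γ : L ≃ₗ[ℤ] L) p ∈ cell q S (realAction q γ x) ↔ p ∈ cell q S x := by
    intro p
    induction p using Projectivization.ind with
    | h v hv => rw [hmk, mk_mem_cell, mk_mem_cell, realBilin_realAction, sameCell_map_iff hγ]
  have hsurj : Function.Surjective (projAct (γ : L ≃ₗ[ℤ] L)) := by
    intro p
    induction p using Projectivization.ind with
    | h v hv =>
      obtain ⟨w, rfl⟩ := (realAction q γ).surjective v
      exact ⟨_, hmk w ((realAction q γ).map_ne_zero_iff.mp hv)⟩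
  have hpreimage : projAct (γ : L ≃ₗ[ℤ] L) ⁻¹' cell q S (realAction q γ x) = cell q S x :=
    Set.ext hmem
  rw [← hpreimage, Set.image_preimage_eq _ hsurj]

instance : IsModuleTopology ℝ (RealSpace L) := ⟨rfl⟩

theorem isOpen_setOf_apply_rep_mul_pos (f g : RealSpace L →ₗ[ℝ] ℝ) :
    IsOpen {p : ℙ ℝ (RealSpace L) | 0 < f p.rep * g p.rep} := by
  have hf : Continuous f := IsModuleTopology.continuous_of_linearMap f
  have hg : Continuous g := IsModuleTopology.continuous_of_linearMap g
  rw [isOpen_coinduced]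
  convert isOpen_lt continuous_const
    ((hf.comp continuous_subtype_val).mul (hg.comp continuous_subtype_val)) using 1
  exact Set.ext fun v => apply_rep_mk_mul_pos_iff f g v.2

theorem apply_rep_mul_pos_of_isPreconnected {C : Set (ℙ ℝ (RealSpace L))} (hC : IsPreconnected C)
    {f g : RealSpace L →ₗ[ℝ] ℝ} (hf : ∀ p ∈ C, f p.rep ≠ 0) (hg : ∀ p ∈ C, g p.rep ≠ 0)
    {p p' : ℙ ℝ (RealSpace L)} (hp : p ∈ C) (hp' : p' ∈ C) (hpos : 0 < f p.rep * g p.rep) :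
    0 < f p'.rep * g p'.rep := by
  refine hC.subset_left_of_subset_union (isOpen_setOf_apply_rep_mul_pos f g)
    (isOpen_setOf_apply_rep_mul_pos f (-g)) ?_ (fun z hz => ?_) ⟨p, hp, hpos⟩ hp'
  · refine Set.disjoint_left.mpr fun z hz hz' => ?_
    rw [Set.mem_ofPred_eq, LinearMap.neg_apply, mul_neg, neg_pos] at hz'
    exact hz'.not_gt hz
  · rw [Set.mem_union, Set.mem_ofPred_eq, Set.mem_ofPred_eq, LinearMap.neg_apply, mul_neg, neg_pos]
    exact (mul_ne_zero (hf z hz) (hg z hz)).lt_or_gt.symm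

theorem isPreconnected_image_mk {C : Set (RealSpace L)} (hC : Convex ℝ C) (hne : ∀ v ∈ C, v ≠ 0) :
    IsPreconnected (Set.range fun v : C => Projectivization.mk ℝ v.1 (hne v v.2)) := by
  have : IsTopologicalAddGroup (RealSpace L) := IsModuleTopology.topologicalAddGroup ℝ _
  have : ContinuousSMul ℝ (RealSpace L) := IsModuleTopology.toContinuousSMul ℝ _
  have : PreconnectedSpace C := isPreconnected_iff_preconnectedSpace.mp hC.isPreconnected
  exact isPreconnected_range ((continuous_coinduced_rng (f := fun v : {v : RealSpace L // v ≠ 0} =>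
    Projectivization.mk ℝ v.1 v.2)).comp (continuous_subtype_val.subtype_mk fun v => hne v v.2))

theorem isPreconnected_cell (h : IsLorentzian (realBilin q)) (hx : 0 < realBilin q x x) :
    IsPreconnected (cell q S x) := by
  convert isPreconnected_image_mk (h.convex_setOf_sameCell (wallNormals S) hx)
    fun v hv => ne_zero_of_apply_self_pos hv.1.1
  refine Set.Subset.antisymm (fun p hp => ?_) ?_
  · have hxp := h.apply_ne_zero hx hp.1
    have hsmul : Projectivization.mk ℝ (realBilin q x p.rep • p.rep)
        (smul_ne_zero hxp p.rep_nonzero) = p := by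
      conv_rhs => rw [← p.mk_rep]
      exact (Projectivization.mk_eq_mk_iff' ℝ _ _ _ _).mpr ⟨_, rfl⟩
    have hmem : realBilin q x p.rep • p.rep ∈ {v | (0 < realBilin q v v ∧ 0 < realBilin q x v) ∧
        SameCell (realBilin q) (wallNormals S) x v} := by
      rw [← hsmul, mk_mem_cell] at hp
      refine ⟨⟨hp.1, ?_⟩, hp.2⟩
      rw [map_smul, smul_eq_mul]
      exact mul_self_pos.mpr hxp
    exact ⟨⟨_, hmem⟩, hsmul⟩
  · rintro _ ⟨v, rfl⟩
    exact (mk_mem_cell _).mpr ⟨v.2.1.1, v.2.2⟩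

theorem subset_cell_of_isPreconnected (h : IsLorentzian (realBilin q))
    {C : Set (ℙ ℝ (RealSpace L))} (hC : IsPreconnected C) {p : ℙ ℝ (RealSpace L)} (hp : p ∈ C)
    (hpos : ∀ p' ∈ C, 0 < realBilin q p'.rep p'.rep)
    (hwall : ∀ p' ∈ C, wallSpan (realBilin q) (wallNormals S) p'.rep =
      wallSpan (realBilin q) (wallNormals S) p.rep) : C ⊆ cell q S p.rep := by
  refine fun p' hp' => ⟨hpos p' hp', fun a ha => ?_⟩
  have hzero : ∀ p₁ ∈ C, ∀ p₂ ∈ C, realBilin q a p₁.rep = 0 → realBilin q a p₂.rep = 0 := by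
    intro p₁ hp₁ p₂ hp₂ hap₁
    refine apply_eq_zero_of_mem_wallSpan (A := wallNormals S) (fun _ _ => id) ?_
    rw [hwall p₂ hp₂, ← hwall p₁ hp₁]
    exact Submodule.subset_span ⟨ha, hap₁⟩
  by_cases hap : realBilin q a p.rep = 0
  · rw [hap, hzero p hp p' hp' hap, sign_zero, mul_zero]
  have hap' := mt (hzero p' hp' p hp) hap
  have hpp' := h.apply_ne_zero (hpos p hp) (hpos p' hp')
  have hsame : 0 < realBilin q p.rep p'.rep * (realBilin q a p.rep • realBilin q a) p'.rep :=
    apply_rep_mul_pos_of_isPreconnected hC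
      (fun z hz => h.apply_ne_zero (hpos p hp) (hpos z hz))
      (fun z hz => mul_ne_zero hap (mt (hzero z hz p hp) hap)) hp hp'
      (mul_pos (hpos p hp) (mul_self_pos.mpr hap))
  rw [LinearMap.smul_apply, smul_eq_mul, ← mul_assoc] at hsame
  rw [← sign_mul, sign_eq_of_mul_nonneg hsame.le (mul_ne_zero hpp' hap) hap']

theorem mem_hypSubspace_iInf_perp {ι : Type*} {s : ι → L} {p : ℙ ℝ (RealSpace L)} :
    p ∈ hypSubspace q (⨅ i, perp q (s i)) ↔
      0 < realBilin q p.rep p.rep ∧ ∀ i, realBilin q ((1 : ℝ) ⊗ₜ[ℤ] s i) p.rep = 0 := by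
  rw [hypSubspace, Set.mem_ofPred_eq, hyperbolicSpace, Set.mem_ofPred_eq, realBilin_self,
    mul_pos_iff_of_pos_left two_pos, Submodule.mem_iInf]
  rfl

theorem mem_iUnion_flats_iff [Module.Finite ℤ L] {k : ℕ} {p : ℙ ℝ (RealSpace L)} :
    p ∈ ⋃ W ∈ flats q S k, hypSubspace q W ↔
      0 < realBilin q p.rep p.rep ∧
        k ≤ finrank ℝ (wallSpan (realBilin q) (wallNormals S) p.rep) := by
  rw [Set.mem_iUnion₂]
  constructor
  · rintro ⟨_, ⟨s, hsS, hli, rfl⟩, hp⟩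
    obtain ⟨hpos, hperp⟩ := mem_hypSubspace_iInf_perp.mp hp
    have hle := Submodule.finrank_mono (span_le_wallSpan fun i => ⟨hsS i, hperp i⟩)
    rw [finrank_span_eq_card hli, Fintype.card_fin] at hle
    exact ⟨hpos, hle⟩
  · rintro ⟨hpos, hk⟩
    obtain ⟨s, hs, hli⟩ := exists_linearIndependent_tuple_perp hk
    exact ⟨_, ⟨s, fun i => (hs i).1, hli, rfl⟩,
      mem_hypSubspace_iInf_perp.mpr ⟨hpos, fun i => (hs i).2⟩⟩

theorem mem_hypSubspace_sdiff_iff [Module.Finite ℤ L] {k : ℕ} {s : Fin k → L} (hsS : ∀ i, s i ∈ S)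
    (hli : LinearIndependent ℝ fun i => ((1 : ℝ) ⊗ₜ[ℤ] s i : RealSpace L))
    {p : ℙ ℝ (RealSpace L)} :
    p ∈ hypSubspace q (⨅ i, perp q (s i)) \ ⋃ W ∈ flats q S (k + 1), hypSubspace q W ↔
      0 < realBilin q p.rep p.rep ∧
        Submodule.span ℝ (Set.range fun i => ((1 : ℝ) ⊗ₜ[ℤ] s i : RealSpace L)) =
          wallSpan (realBilin q) (wallNormals S) p.rep := by
  rw [Set.mem_sdiff, mem_hypSubspace_iInf_perp, mem_iUnion_flats_iff, not_and, not_le,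
    Nat.lt_succ_iff, and_assoc]
  refine and_congr_right fun hpos => ⟨fun ⟨hperp, hrank⟩ => ?_, fun hspan => ?_⟩
  · exact (span_eq_wallSpan_iff fun i => ⟨hsS i, hperp i⟩) hli |>.mpr
      ((hrank hpos).trans_eq (Fintype.card_fin k).symm)
  · have hperp : ∀ i, realBilin q ((1 : ℝ) ⊗ₜ[ℤ] s i) p.rep = 0 := fun i =>
      apply_eq_zero_of_mem_wallSpan (fun _ _ => id)
        (hspan ▸ Submodule.subset_span (Set.mem_range_self i))
    refine ⟨hperp, fun _ => ?_⟩
    exact ((span_eq_wallSpan_iff (fun i => ⟨hsS i, hperp i⟩) hli).mp hspan).trans_eq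
      (Fintype.card_fin k)

theorem connectedComponentIn_hypSubspace_sdiff [Module.Finite ℤ L]
    (h : IsLorentzian (realBilin q)) {k : ℕ} {s : Fin k → L} (hsS : ∀ i, s i ∈ S)
    (hli : LinearIndependent ℝ fun i => ((1 : ℝ) ⊗ₜ[ℤ] s i : RealSpace L))
    {p : ℙ ℝ (RealSpace L)}
    (hp : p ∈ hypSubspace q (⨅ i, perp q (s i)) \ ⋃ W ∈ flats q S (k + 1), hypSubspace q W) :
    connectedComponentIn
      (hypSubspace q (⨅ i, perp q (s i)) \ ⋃ W ∈ flats q S (k + 1), hypSubspace q W) p =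
        cell q S p.rep := by
  have hmem := fun p => mem_hypSubspace_sdiff_iff (q := q) hsS hli (p := p)
  set U := hypSubspace q (⨅ i, perp q (s i)) \ ⋃ W ∈ flats q S (k + 1), hypSubspace q W
  obtain ⟨hpos, hspan⟩ := (hmem p).mp hp
  have hsub := connectedComponentIn_subset U p
  refine Set.Subset.antisymm ?_ ?_
  · exact subset_cell_of_isPreconnected h isPreconnected_connectedComponentIn
      (mem_connectedComponentIn hp) (fun p' hp' => ((hmem p').mp (hsub hp')).1)
      fun p' hp' => ((hmem p').mp (hsub hp')).2.symm.trans hspan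
  · refine (isPreconnected_cell h hpos).subset_connectedComponentIn ⟨hpos, SameCell.refl hpos⟩ ?_
    exact fun p' ⟨hpos', hpp'⟩ =>
      (hmem p').mpr ⟨hpos', hspan.trans (hpp'.wallSpan_eq h hpos hpos')⟩

theorem mem_faces_iff [Module.Finite ℤ L] (h : IsLorentzian (realBilin q)) {n d : ℕ}
    {F : Set (ℙ ℝ (RealSpace L))} :
    F ∈ faces q S n d ↔ ∃ x, 0 < realBilin q x x ∧
      finrank ℝ (wallSpan (realBilin q) (wallNormals S) x) + d = n ∧ F = cell q S x := by
  constructor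
  · rintro ⟨k, rfl, _, ⟨s, hsS, hli, rfl⟩, p, hp, rfl⟩
    obtain ⟨hpos, hspan⟩ := (mem_hypSubspace_sdiff_iff hsS hli).mp hp
    refine ⟨p.rep, hpos, ?_, connectedComponentIn_hypSubspace_sdiff h hsS hli hp⟩
    rw [← hspan, finrank_span_eq_card hli, Fintype.card_fin]
  · rintro ⟨x, hx, hrank, rfl⟩
    obtain ⟨hpos, hxp⟩ := (mk_mem_cell (q := q) (S := S) (ne_zero_of_apply_self_pos hx)).mpr
      ⟨hx, SameCell.refl hx⟩
    rw [hxp.wallSpan_eq h hx hpos] at hrank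
    rw [cell_eq_of_sameCell h hx hpos hxp]
    obtain ⟨s, hs, hli⟩ := exists_linearIndependent_tuple_perp (q := q) (S := S) le_rfl
    have hp := (mem_hypSubspace_sdiff_iff (fun i => (hs i).1) hli).mpr
      ⟨hpos, (span_eq_wallSpan_iff hs hli).mpr (Fintype.card_fin _).ge⟩
    exact ⟨_, hrank, _, ⟨s, fun i => (hs i).1, hli, rfl⟩, _, hp,
      (connectedComponentIn_hypSubspace_sdiff h (fun i => (hs i).1) hli hp).symm⟩

end Faces

section Orbits

variable {L : Type*} [AddCommGroup L] {q : QuadraticForm ℤ L} {S : Set L}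

theorem image_mem_faces [Module.Finite ℤ L] (h : IsLorentzian (realBilin q))
    {γ : orthogonalGroup q}
    (hγ : realAction q γ ∈ wallSymmetries (realBilin q) (wallNormals S)) {n d : ℕ}
    {F : Set (ℙ ℝ (RealSpace L))} (hF : F ∈ faces q S n d) :
    projAct (γ : L ≃ₗ[ℤ] L) '' F ∈ faces q S n d := by
  obtain ⟨x, hx, hrank, rfl⟩ := (mem_faces_iff h).mp hF
  refine (mem_faces_iff h).mpr ⟨realAction q γ x, ?_, ?_, image_cell hγ x⟩
  · rwa [realBilin_realAction]
  · rwa [wallSpan_map hγ, LinearEquiv.finrank_map_eq]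

theorem orbitSet_invariant (Γ : Subgroup (orthogonalGroup q)) (S₀ : Set L) :
    ∀ γ ∈ Γ, ∀ s ∈ orbitSet Γ S₀, (γ : L ≃ₗ[ℤ] L) s ∈ orbitSet Γ S₀ := by
  rintro γ hγ _ ⟨δ, hδ, s₀, hs₀, rfl⟩
  exact ⟨γ * δ, Γ.mul_mem hγ hδ, s₀, hs₀, rfl⟩

theorem image_orbitSet_subset (Γ : Subgroup (orthogonalGroup q)) (S₀ : Set L) :
    q '' orbitSet Γ S₀ ⊆ q '' S₀ := by
  rintro _ ⟨_, ⟨γ, _, s₀, hs₀, rfl⟩, rfl⟩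
  exact ⟨s₀, hs₀, (γ.2 s₀).symm⟩

theorem exists_neg_le_polarBilin_self (hS : BddBelow (q '' S)) :
    ∃ N : ℤ, ∀ s ∈ S, -N ≤ q.polarBilin s s := by
  obtain ⟨M, hM⟩ := hS
  refine ⟨-(2 * M), fun s hs => ?_⟩
  have := hM ⟨s, hs, rfl⟩
  rw [QuadraticMap.polarBilin_apply_apply, QuadraticMap.polar_self, two_nsmul]
  linarith

end Orbits

end HypTess

open HypTess in
theorem mainTheorem12_general {L : Type*} [AddCommGroup L] [Module.Free ℤ L] [Module.Finite ℤ L]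
    {n : ℕ} {q : QuadraticForm ℤ L} (hq : HasSignature q 1 n)
    (Γ : Subgroup (orthogonalGroup q)) [Γ.FiniteIndex] {S : Set L}
    (hS : ∀ γ ∈ Γ, ∀ s ∈ S, (γ : L ≃ₗ[ℤ] L) s ∈ S) (hbdd : BddBelow (q '' S)) (d : ℕ) :
    (∀ γ ∈ Γ, ∀ F ∈ faces q S n d, projAct (γ : L ≃ₗ[ℤ] L) '' F ∈ faces q S n d) ∧
    ∃ T : Set (Set (ℙ ℝ (RealSpace L))), T.Finite ∧ T ⊆ faces q S n d ∧
      ∀ F ∈ faces q S n d, ∃ F' ∈ T, ∃ γ ∈ Γ, F = projAct (γ : L ≃ₗ[ℤ] L) '' F' := by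
  have h := hq.isLorentzian
  have hsymm : ∀ γ ∈ Γ, realAction q γ ∈ wallSymmetries (realBilin q) (wallNormals S) :=
    fun γ hγ => map_realAction_le_wallSymmetries hS ⟨γ, hγ, rfl⟩
  obtain ⟨N, hN⟩ := exists_neg_le_polarBilin_self hbdd
  obtain ⟨T, hT, hTpos, hrep⟩ := finitelyManyCellOrbits_wallNormals h hS hN
  refine ⟨fun γ hγ F => image_mem_faces h (hsymm γ hγ), cell q S '' T ∩ faces q S n d,
    (hT.image _).inter_of_left _, Set.inter_subset_right, fun F hF => ?_⟩
  obtain ⟨x, hx, hrank, rfl⟩ := (mem_faces_iff h).mp hF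
  obtain ⟨t, ht, _, ⟨γ, hγ, rfl⟩, hcell⟩ := hrep x trivial hx
  have hpos : 0 < realBilin q (realAction q γ t) (realAction q γ t) := by
    rw [realBilin_realAction]
    exact hTpos t ht
  refine ⟨cell q S t, ⟨⟨t, ht, rfl⟩, (mem_faces_iff h).mpr ⟨t, hTpos t ht, ?_, rfl⟩⟩, γ, hγ, ?_⟩
  · rwa [← hcell.wallSpan_eq h hpos hx, wallSpan_map (hsymm γ hγ),
      LinearEquiv.finrank_map_eq] at hrank
  · rw [image_cell (hsymm γ hγ), cell_eq_of_sameCell h hpos hx hcell]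

theorem mainTheorem12 {L : Type*} [AddCommGroup L] [Module.Free ℤ L] [Module.Finite ℤ L]
    (n : ℕ) (q : QuadraticForm ℤ L) (hq : HypTess.HasSignature q 1 n)
    (Γ : Subgroup (HypTess.orthogonalGroup q)) (hΓ : Γ.FiniteIndex)
    (S₀ : Set L) (hfin : S₀.Finite) (hneg : ∀ s ∈ S₀, q s < 0) (d : ℕ) :
    -- `Γ` maps `d`-dimensional faces to `d`-dimensional faces
    (∀ γ ∈ Γ, ∀ F ∈ HypTess.faces q (HypTess.orbitSet Γ S₀) n d,
      HypTess.projAct (γ : L ≃ₗ[ℤ] L) '' F ∈ HypTess.faces q (HypTess.orbitSet Γ S₀) n d) ∧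
    -- and finitely many faces represent all orbits
    ∃ T : Set (Set (Projectivization ℝ (HypTess.RealSpace L))),
      T.Finite ∧ T ⊆ HypTess.faces q (HypTess.orbitSet Γ S₀) n d ∧
      ∀ F ∈ HypTess.faces q (HypTess.orbitSet Γ S₀) n d,
        ∃ F' ∈ T, ∃ γ ∈ Γ, F = HypTess.projAct (γ : L ≃ₗ[ℤ] L) '' F' :=
  mainTheorem12_general hq Γ (HypTess.orbitSet_invariant Γ S₀)
    ((hfin.image q).bddBelow.mono (HypTess.image_orbitSet_subset Γ S₀)) d
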